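/- Let $q$ be a fixed odd prime power and let $\varepsilon\in\{+,-\}$. A nondegenerate quadratic form on a $2n$-dimensional vector space over $\mathbb F_q$ ($n\ge 1$) is said to be of type $+$ if it has a totally singular subspace of dimension $n$ (a subspace on which the form vanishes identically), and of type $-$ if every totally singular subspace has dimension at most $n-1$. Let $O^{\varepsilon}(2n,q)$ be the group of all linear isometries of a nondegenerate quadratic form of type $\varepsilon$ on a $2n$-dimensional space over $\mathbb F_q$, and let $i_O^{\varepsilon}(2n,q)$ be the number of involutions in $O^{\varepsilon}(2n,q)$, that is, of elements $g$ with $g^2=1$ (the identity is counted; this does not affect the limit). Then, for each choice of the forms, the product below converges and \[ \lim_{n\to\infty}\frac{i_O^{\varepsilon}(2n,q)}{q^{n^2}}=\prod_{i\ge 1}\left(1+\frac1{q^{2i-1}}\right)^2 \] for both $\varepsilon=+$ and $\varepsilon=-$. -/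

import Mathlib

open Filter Topology

/-- The isometry group (orthogonal group) `O(V, Q)` of a quadratic space `(V, Q)`: the group of all
linear automorphisms `g` of `V` with `Q (g v) = Q v` for all `v`. -/
def quadraticOrthogonalGroup {F V : Type*} [Field F] [AddCommGroup V] [Module F V]
    (Q : QuadraticForm F V) : Subgroup (V ≃ₗ[F] V) where
  carrier := {g | ∀ v, Q (g v) = Q v}
  mul_mem' {a b} ha hb v := by
    rw [LinearEquiv.mul_apply, ha, hb]
  one_mem' _ := rfl
  inv_mem' {a} ha v := by
    have h := ha (a⁻¹ v)
    rw [← LinearEquiv.mul_apply, mul_inv_cancel, LinearEquiv.coe_one, id] at h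
    exact h.symm

/-- The number of elements `g` of a group with `g ^ 2 = 1`. The identity is counted. -/
noncomputable def numInvolutions (G : Type*) [Group G] : ℕ :=
  Nat.card {g : G // g ^ 2 = 1}

/-- A subspace on which the quadratic form vanishes identically. -/
def IsTotallySingular {F V : Type*} [Field F] [AddCommGroup V] [Module F V]
    (Q : QuadraticForm F V) (W : Submodule F V) : Prop :=
  ∀ w ∈ W, Q w = 0

/-- The two signs `+` and `-` of even-dimensional nondegenerate quadratic forms. -/
inductive OrthogonalType
  | plus
  | minus

/-- A quadratic form `Q` on a space of dimension `2n` has type `+` if there is a totally singular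
subspace of dimension `n`, and type `-` if all totally singular subspaces have dimension less
than `n`. -/
def HasOrthogonalType {F V : Type*} [Field F] [AddCommGroup V] [Module F V]
    (Q : QuadraticForm F V) (n : ℕ) : OrthogonalType → Prop
  | .plus => ∃ W : Submodule F V, IsTotallySingular Q W ∧ Module.finrank F W = n
  | .minus => ∀ W : Submodule F V, IsTotallySingular Q W → Module.finrank F W < n

/-! In odd characteristic an isometry `g` with `g ^ 2 = 1` is determined by its `-1`-eigenspace. The
polar form is nondegenerate on that eigenspace, and every such ("nonsingular") subspace occurs
(`numInvolutions_eq_card_isNonsingular`). It remains to count nonsingular `k`-subspaces of a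
nonsingular `2n`-space.

Double counting against anisotropic vectors and hyperbolic pairs gives `q^(k(2n-k))` times a
Gaussian binomial in `t = q⁻²`: upper index `n` and lower index `k/2` for even `k`
(`card_nonsingularSubspaces_even_even`), upper index `n-1` and lower index `(k-1)/2` for odd `k`,
with an extra factor `c = 1 + O(q⁻ⁿ)` (`card_nonsingularSubspaces_odd_even`). The type is felt only
through `c`.

Since `k(2n-k) - n² = -(k-n)²`, dividing by `q^(n²)` leaves a sum of `y^((k-n)²)` times bounded
coefficients, `y = q⁻¹`. For fixed `k-n` these tend to `1/L`, where `L = ∏ (1 - t^i)`. The finite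
Jacobi triple product (`thetaSum_self`) writes the partial product `∏ (1 + y^(2i+1))²` as the same
sum with coefficients the Gaussian binomials of `2n` over `k`, which also tend to `1/L`. By
dominated convergence (`tendsto_sum_pow_sq_mul`) the difference vanishes, without evaluating either
limit. -/

open Module
open LinearMap (BilinForm)

/-! ### Nonsingular subspaces and orthogonal splittings -/

section Nonsingular

variable {F V : Type*} [Field F] [AddCommGroup V] [Module F V]

/-- A subspace on which the bilinear form `B` is nondegenerate. -/
def IsNonsingular (B : BilinForm F V) (W : Submodule F V) : Prop :=
  Disjoint W (B.orthogonal W)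

theorem IsNonsingular.eq_zero {B : BilinForm F V} {W : Submodule F V} (hW : IsNonsingular B W)
    {x : V} (hx : x ∈ W) (h : ∀ w ∈ W, B w x = 0) : x = 0 :=
  Submodule.disjoint_def.1 hW x hx h

theorem isNonsingular_of_forall {B : BilinForm F V} {W : Submodule F V}
    (h : ∀ x ∈ W, (∀ w ∈ W, B w x = 0) → x = 0) : IsNonsingular B W :=
  Submodule.disjoint_def.2 h

theorem isNonsingular_bot (B : BilinForm F V) : IsNonsingular B ⊥ := disjoint_bot_left

variable {B : BilinForm F V}

theorem IsNonsingular.sup {A X : Submodule F V} (hA : IsNonsingular B A)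
    (hX : IsNonsingular B X) (hXA : X ≤ B.orthogonal A) : IsNonsingular B (A ⊔ X) := by
  refine isNonsingular_of_forall fun x hx h => ?_
  obtain ⟨a, ha, b, hb, rfl⟩ := Submodule.mem_sup.1 hx
  have ha0 : a = 0 := hA.eq_zero ha fun w hw => by
    have := h w (Submodule.mem_sup_left hw)
    rwa [map_add, hXA hb w hw, add_zero] at this
  subst ha0
  rw [zero_add] at h ⊢
  exact hX.eq_zero hb fun w hw => h w (Submodule.mem_sup_right hw)

theorem IsNonsingular.sup_inf_orthogonal_self {A X : Submodule F V} (hA : IsNonsingular B A)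
    (hXA : X ≤ B.orthogonal A) : (A ⊔ X) ⊓ B.orthogonal A = X := by
  rw [sup_comm, sup_inf_assoc_of_le _ hXA, hA.eq_bot, sup_bot_eq]

theorem isNonsingular_span_singleton {v : V} (hv : B v v ≠ 0) : IsNonsingular B (F ∙ v) :=
  (LinearMap.BilinForm.isCompl_span_singleton_orthogonal hv).disjoint

variable (hB : B.IsSymm)
include hB

theorem isNonsingular_span_pair {u w : V} (hu : B u u = 0) (hw : B w w = 0) (huw : B u w = 1) :
    IsNonsingular B (Submodule.span F {u, w}) := by
  have hwu : B w u = 1 := by rw [← huw]; exact hB.eq w u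
  refine isNonsingular_of_forall fun x hx h => ?_
  obtain ⟨a, b, rfl⟩ := Submodule.mem_span_pair.1 hx
  have h1 := h u (Submodule.subset_span (by simp))
  have h2 := h w (Submodule.subset_span (by simp))
  simp [hu, hw, huw, hwu] at h1 h2
  simp [h1, h2]

theorem finrank_span_pair_of_hyperbolic {u w : V} (hu : B u u = 0) (hw : B w w = 0)
    (huw : B u w = 1) : finrank F (Submodule.span F {u, w}) = 2 := by
  have hwu : B w u = 1 := by rw [← huw]; exact hB.eq w u
  have hli : LinearIndependent F ![u, w] := by
    refine LinearIndependent.pair_iff.2 fun a b h => ?_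
    have h1 := congrArg (B u) h
    have h2 := congrArg (B w) h
    simp [hu, hw, huw, hwu] at h1 h2
    exact ⟨h2, h1⟩
  have := finrank_span_eq_card hli
  rwa [Matrix.range_cons_cons_empty] at this

variable [FiniteDimensional F V]

theorem IsNonsingular.isCompl {W : Submodule F V} (hW : IsNonsingular B W) :
    IsCompl W (B.orthogonal W) :=
  (LinearMap.BilinForm.isCompl_orthogonal_iff_disjoint hB.isRefl).2 hW

theorem IsNonsingular.sup_inf_orthogonal {A U : Submodule F V} (hA : IsNonsingular B A)
    (hAU : A ≤ U) : A ⊔ U ⊓ B.orthogonal A = U := by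
  rw [inf_comm, ← sup_inf_assoc_of_le _ hAU, (hA.isCompl hB).sup_eq_top, top_inf_eq]

/-- A vector of `A⊥` orthogonal to `U ∩ A⊥` is orthogonal to `A` and to `U ∩ A⊥`, hence to their sum
`U`. -/
theorem IsNonsingular.inf_orthogonal {A U : Submodule F V} (hA : IsNonsingular B A)
    (hU : IsNonsingular B U) (hAU : A ≤ U) : IsNonsingular B (U ⊓ B.orthogonal A) := by
  refine isNonsingular_of_forall fun x hx h => hU.eq_zero hx.1 fun w hw => ?_
  rw [← hA.sup_inf_orthogonal hB hAU] at hw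
  obtain ⟨a, ha, b, hb, rfl⟩ := Submodule.mem_sup.1 hw
  rw [map_add, LinearMap.add_apply, hx.2 a ha, h b hb, add_zero]

theorem IsNonsingular.finrank_inf_orthogonal {A U : Submodule F V} (hA : IsNonsingular B A)
    (hAU : A ≤ U) : finrank F A + finrank F ↥(U ⊓ B.orthogonal A) = finrank F U := by
  have h := Submodule.finrank_sup_add_finrank_inf_eq A (U ⊓ B.orthogonal A)
  rw [hA.sup_inf_orthogonal hB hAU, (hA.mono_right inf_le_right).eq_bot, finrank_bot] at h
  omega

theorem IsNonsingular.inf_orthogonal_inf_orthogonal {A U : Submodule F V}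
    (hA : IsNonsingular B A) (hU : IsNonsingular B U) (hAU : A ≤ U) :
    U ⊓ B.orthogonal (U ⊓ B.orthogonal A) = A := by
  have hA' := hA.inf_orthogonal hB hU hAU
  have hle : A ≤ U ⊓ B.orthogonal (U ⊓ B.orthogonal A) :=
    le_inf hAU fun a ha x hx => hB.isRefl _ _ (hx.2 a ha)
  refine (Submodule.eq_of_le_of_finrank_eq hle ?_).symm
  have h1 := hA.finrank_inf_orthogonal hB hAU
  have h2 := hA'.finrank_inf_orthogonal hB inf_le_left
  omega

end Nonsingular

/-! ### Double counting of nonsingular subspaces -/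

section Counting

variable {F V : Type*} [Field F] [AddCommGroup V] [Module F V] [Finite V]

/-- The nonsingular subspaces of dimension `k` of a subspace `U`. -/
noncomputable def nonsingularSubspaces (B : BilinForm F V) (U : Submodule F V) (k : ℕ) :
    Finset (Submodule F V) :=
  (Set.toFinite {W | W ≤ U ∧ IsNonsingular B W ∧ finrank F W = k}).toFinset

/-- The nonzero isotropic vectors of a subspace. -/
noncomputable def isotropicVectors (B : BilinForm F V) (U : Submodule F V) : Finset V :=
  (Set.toFinite {v | v ∈ U ∧ v ≠ 0 ∧ B v v = 0}).toFinset

/-- The anisotropic vectors of a subspace. -/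
noncomputable def anisotropicVectors (B : BilinForm F V) (U : Submodule F V) : Finset V :=
  (Set.toFinite {v | v ∈ U ∧ B v v ≠ 0}).toFinset

/-- The hyperbolic pairs of a subspace. -/
noncomputable def hyperbolicPairs (B : BilinForm F V) (U : Submodule F V) : Finset (V × V) :=
  (Set.toFinite {p : V × V | p.1 ∈ U ∧ p.2 ∈ U ∧
    B p.1 p.1 = 0 ∧ B p.2 p.2 = 0 ∧ B p.1 p.2 = 1}).toFinset

variable {B : BilinForm F V} {U : Submodule F V}

@[simp] theorem mem_nonsingularSubspaces {k : ℕ} {W : Submodule F V} :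
    W ∈ nonsingularSubspaces B U k ↔ W ≤ U ∧ IsNonsingular B W ∧ finrank F W = k := by
  simp [nonsingularSubspaces]

@[simp] theorem mem_isotropicVectors {v : V} :
    v ∈ isotropicVectors B U ↔ v ∈ U ∧ v ≠ 0 ∧ B v v = 0 := by
  simp [isotropicVectors]

@[simp] theorem mem_anisotropicVectors {v : V} :
    v ∈ anisotropicVectors B U ↔ v ∈ U ∧ B v v ≠ 0 := by
  simp [anisotropicVectors]

@[simp] theorem mem_hyperbolicPairs {p : V × V} :
    p ∈ hyperbolicPairs B U ↔ p.1 ∈ U ∧ p.2 ∈ U ∧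
      B p.1 p.1 = 0 ∧ B p.2 p.2 = 0 ∧ B p.1 p.2 = 1 := by
  simp [hyperbolicPairs]

theorem card_toFinset_submodule (U : Submodule F V) :
    (Set.toFinite (U : Set V)).toFinset.card = Nat.card F ^ finrank F U := by
  rw [← Set.ncard_eq_toFinset_card, ← Nat.card_coe_set_eq]
  exact Module.natCard_eq_pow_finrank

theorem card_isotropicVectors_add_card_anisotropicVectors :
    (isotropicVectors B U).card + (anisotropicVectors B U).card + 1 =
      Nat.card F ^ finrank F U := by
  classical
  have h0 : Disjoint (isotropicVectors B U) (anisotropicVectors B U) :=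
    Finset.disjoint_left.2 fun v h1 h2 =>
      (mem_anisotropicVectors.1 h2).2 (mem_isotropicVectors.1 h1).2.2
  have h1 : (0 : V) ∉ isotropicVectors B U ∪ anisotropicVectors B U := by simp
  rw [← card_toFinset_submodule, ← Finset.card_union_of_disjoint h0,
    ← Finset.card_insert_of_notMem h1]
  congr 1
  ext v
  by_cases hv : v = 0
  · simp [hv]
  · by_cases hq : B v v = 0 <;> simp [hv, hq]

theorem card_nonsingularSubspaces_zero : (nonsingularSubspaces B U 0).card = 1 := by
  rw [Finset.card_eq_one]
  refine ⟨⊥, ?_⟩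
  ext W
  simp only [mem_nonsingularSubspaces, Finset.mem_singleton, Submodule.finrank_eq_zero]
  exact ⟨fun h => h.2.2, by rintro rfl; exact ⟨bot_le, isNonsingular_bot B, rfl⟩⟩

variable (hB : B.IsSymm)
include hB

/-- Splitting off `A`: the maps `W ↦ W ∩ A⊥` and `X ↦ A ⊔ X` are mutually inverse and preserve
nonsingularity. -/
theorem card_filter_nonsingularSubspaces {A : Submodule F V} [DecidablePred (A ≤ ·)]
    (hA : IsNonsingular B A) (hAU : A ≤ U) (k : ℕ) :
    ((nonsingularSubspaces B U (k + finrank F A)).filter (A ≤ ·)).card =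
      (nonsingularSubspaces B (U ⊓ B.orthogonal A) k).card := by
  refine Finset.card_nbij' (· ⊓ B.orthogonal A) (A ⊔ ·) ?_ ?_ ?_ ?_
  · intro W hW
    simp only [Finset.coe_filter, mem_nonsingularSubspaces, Set.mem_ofPred_eq] at hW
    obtain ⟨⟨hWU, hW, hk⟩, hAW⟩ := hW
    simp only [Finset.mem_coe, mem_nonsingularSubspaces]
    have := hA.finrank_inf_orthogonal hB hAW
    exact ⟨inf_le_inf_right _ hWU, hA.inf_orthogonal hB hW hAW, by omega⟩
  · intro X hX
    simp only [Finset.mem_coe, mem_nonsingularSubspaces] at hX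
    obtain ⟨hXU, hX, hk⟩ := hX
    have hXA := hXU.trans inf_le_right
    simp only [Finset.coe_filter, mem_nonsingularSubspaces, Set.mem_ofPred_eq]
    have := hA.finrank_inf_orthogonal hB (le_sup_left : A ≤ A ⊔ X)
    rw [hA.sup_inf_orthogonal_self hXA] at this
    exact ⟨⟨sup_le hAU (hXU.trans inf_le_left), hA.sup hX hXA, by omega⟩, le_sup_left⟩
  · intro W hW
    simp only [Finset.coe_filter, mem_nonsingularSubspaces, Set.mem_ofPred_eq] at hW
    exact hA.sup_inf_orthogonal hB hW.2
  · intro X hX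
    simp only [Finset.mem_coe, mem_nonsingularSubspaces] at hX
    exact hA.sup_inf_orthogonal_self (hX.1.trans inf_le_right)

/-- Counts the pairs `(W, x)` with `A x ≤ W` in two ways. It is stated abstractly to serve both for
anisotropic vectors (`A x` a line) and for hyperbolic pairs (`A x` a plane). -/
theorem sum_card_eq_sum_card_nonsingularSubspaces {α : Type*} (f : Submodule F V → Finset α)
    (A : α → Submodule F V) {a : ℕ}
    (hA : ∀ x ∈ f U, IsNonsingular B (A x) ∧ finrank F (A x) = a ∧ A x ≤ U)
    (hf : ∀ W ≤ U, ∀ x, x ∈ f W ↔ x ∈ f U ∧ A x ≤ W) (k : ℕ) :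
    ∑ W ∈ nonsingularSubspaces B U (k + a), (f W).card =
      ∑ x ∈ f U, (nonsingularSubspaces B (U ⊓ B.orthogonal (A x)) k).card := by
  classical
  have h := Finset.sum_card_bipartiteAbove_eq_sum_card_bipartiteBelow
    (s := nonsingularSubspaces B U (k + a)) (t := f U) (fun W x => A x ≤ W)
  convert h using 1
  · refine Finset.sum_congr rfl fun W hW => congrArg _ ?_
    ext x
    rw [hf W (mem_nonsingularSubspaces.1 hW).1, Finset.mem_bipartiteAbove]
  · refine Finset.sum_congr rfl fun x hx => ?_
    obtain ⟨h1, rfl, h3⟩ := hA x hx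
    exact (card_filter_nonsingularSubspaces hB h1 h3 k).symm

theorem sum_card_anisotropicVectors (k : ℕ) :
    ∑ W ∈ nonsingularSubspaces B U (k + 1), (anisotropicVectors B W).card =
      ∑ v ∈ anisotropicVectors B U,
        (nonsingularSubspaces B (U ⊓ B.orthogonal (F ∙ v)) k).card := by
  refine sum_card_eq_sum_card_nonsingularSubspaces hB _ _ (fun v hv => ?_)
    (fun W hW v => ?_) k
  · rw [mem_anisotropicVectors] at hv
    refine ⟨isNonsingular_span_singleton hv.2, finrank_span_singleton ?_, ?_⟩
    · rintro rfl
      simp at hv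
    · simpa using hv.1
  · simp only [mem_anisotropicVectors, Submodule.span_singleton_le_iff_mem]
    exact ⟨fun h => ⟨⟨hW h.1, h.2⟩, h.1⟩, fun h => ⟨h.2, h.1.2⟩⟩

theorem sum_card_hyperbolicPairs (k : ℕ) :
    ∑ W ∈ nonsingularSubspaces B U (k + 2), (hyperbolicPairs B W).card =
      ∑ p ∈ hyperbolicPairs B U,
        (nonsingularSubspaces B (U ⊓ B.orthogonal (Submodule.span F {p.1, p.2})) k).card := by
  refine sum_card_eq_sum_card_nonsingularSubspaces hB _ _ (fun v hv => ?_)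
    (fun W hW v => ?_) k
  · rw [mem_hyperbolicPairs] at hv
    obtain ⟨h1, h2, h3, h4, h5⟩ := hv
    refine ⟨isNonsingular_span_pair hB h3 h4 h5, finrank_span_pair_of_hyperbolic hB h3 h4 h5, ?_⟩
    simp [Submodule.span_le, Set.insert_subset_iff, h1, h2]
  · simp only [mem_hyperbolicPairs, Submodule.span_le, Set.insert_subset_iff,
      Set.singleton_subset_iff, SetLike.mem_coe]
    exact ⟨fun h => ⟨⟨hW h.1, hW h.2.1, h.2.2⟩, h.1, h.2.1⟩,
      fun h => ⟨h.2.1, h.2.2, h.1.2.2⟩⟩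

/-- Taking the orthogonal complement inside `U` is an involution on nonsingular subspaces. -/
theorem card_nonsingularSubspaces_complement (hU : IsNonsingular B U) {k l : ℕ}
    (hkl : k + l = finrank F U) :
    (nonsingularSubspaces B U k).card = (nonsingularSubspaces B U l).card := by
  have key : ∀ {k l : ℕ}, k + l = finrank F U → ∀ W ∈ nonsingularSubspaces B U k,
      U ⊓ B.orthogonal W ∈ nonsingularSubspaces B U l := by
    intro k l hkl W hW
    rw [mem_nonsingularSubspaces] at hW ⊢
    have := hW.2.1.finrank_inf_orthogonal hB hW.1
    exact ⟨inf_le_left, hW.2.1.inf_orthogonal hB hU hW.1, by omega⟩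
  have hinv : ∀ {k : ℕ}, ∀ W ∈ nonsingularSubspaces B U k,
      U ⊓ B.orthogonal (U ⊓ B.orthogonal W) = W := fun W hW =>
    (mem_nonsingularSubspaces.1 hW).2.1.inf_orthogonal_inf_orthogonal hB hU
      (mem_nonsingularSubspaces.1 hW).1
  exact Finset.card_nbij' (U ⊓ B.orthogonal ·) (U ⊓ B.orthogonal ·) (key hkl)
    (key ((add_comm l k).trans hkl)) hinv hinv

end Counting

/-! ### Isotropic vectors and hyperbolic pairs over a finite field -/

section VectorCounts

variable {F V : Type*} [Field F] [AddCommGroup V] [Module F V]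
  {B : BilinForm F V} {U : Submodule F V}

theorem IsNonsingular.exists_pairing_eq_one (hB : B.IsSymm) (hU : IsNonsingular B U) {u : V}
    (hu : u ∈ U) (hu0 : u ≠ 0) : ∃ w ∈ U, B u w = 1 := by
  by_contra! h
  refine hu0 (hU.eq_zero hu fun w hw => ?_)
  by_contra h0
  have h1 : B u w ≠ 0 := by rwa [hB.eq]
  refine h ((B u w)⁻¹ • w) (U.smul_mem _ hw) ?_
  simp [h1]

theorem mem_orthogonal_span_pair {u w v : V} :
    v ∈ B.orthogonal (Submodule.span F {u, w}) ↔ B u v = 0 ∧ B w v = 0 := by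
  refine ⟨fun h => ⟨h u (Submodule.subset_span (by simp)), h w (Submodule.subset_span (by simp))⟩,
    fun h x hx => ?_⟩
  obtain ⟨a, b, rfl⟩ := Submodule.mem_span_pair.1 hx
  simp [h.1, h.2]

variable [Finite V]

/-- Every nonzero isotropic `u` has `q^(dim U - 2)` hyperbolic partners: after fixing `c u` with `B
u (c u) = 1`, each `x ∈ U` is uniquely `w + s • u + t • c u` with `(u, w)` hyperbolic. -/
theorem card_hyperbolicPairs [Fintype F] (hB : B.IsSymm) (h2 : (2 : F) ≠ 0)
    (hU : IsNonsingular B U) :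
    (hyperbolicPairs B U).card * Nat.card F ^ 2 =
      (isotropicVectors B U).card * Nat.card F ^ finrank F U := by
  have hex : ∀ u : V, ∃ w, u ∈ U → u ≠ 0 → w ∈ U ∧ B u w = 1 := fun u => by
    by_cases h : u ∈ U ∧ u ≠ 0
    · obtain ⟨w, hw⟩ := hU.exists_pairing_eq_one hB h.1 h.2
      exact ⟨w, fun _ _ => hw⟩
    · exact ⟨0, fun h1 h2 => (h ⟨h1, h2⟩).elim⟩
  choose c hc using hex
  have hq : Nat.card F ^ 2 = ((Finset.univ : Finset F) ×ˢ (Finset.univ : Finset F)).card := by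
    rw [Finset.card_product, Finset.card_univ, Nat.card_eq_fintype_card, sq]
  rw [hq, ← Finset.card_product, ← card_toFinset_submodule, ← Finset.card_product]
  -- Pairing with `u` forces `t = B u x - 1`; then `x - t • c u = w + s • u` has square `2 * s`,
  -- which determines `s`.
  refine Finset.card_nbij'
    (fun x => (x.1.1, x.1.2 + x.2.1 • x.1.1 + x.2.2 • c x.1.1))
    (fun y => ((y.1, y.2 - (B y.1 y.2 - 1) • c y.1 -
      (B (y.2 - (B y.1 y.2 - 1) • c y.1) (y.2 - (B y.1 y.2 - 1) • c y.1) / 2) • y.1),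
      B (y.2 - (B y.1 y.2 - 1) • c y.1) (y.2 - (B y.1 y.2 - 1) • c y.1) / 2,
      B y.1 y.2 - 1)) ?_ ?_ ?_ ?_
  · rintro ⟨⟨u, w⟩, s, t⟩ h
    simp only [Finset.coe_product, Set.mem_prod, Finset.mem_coe, mem_hyperbolicPairs] at h
    obtain ⟨⟨hu, hw, huu, hww, huw⟩, -⟩ := h
    have hu0 : u ≠ 0 := by rintro rfl; simp at huw
    simp only [Finset.coe_product, Set.mem_prod, mem_isotropicVectors,
      Set.Finite.mem_toFinset, SetLike.mem_coe]
    exact ⟨⟨hu, hu0, huu⟩, U.add_mem (U.add_mem hw (U.smul_mem _ hu))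
      (U.smul_mem _ (hc u hu hu0).1)⟩
  · rintro ⟨u, x⟩ h
    simp only [Finset.coe_product, Set.mem_prod, mem_isotropicVectors,
      Set.Finite.mem_toFinset, SetLike.mem_coe] at h
    obtain ⟨⟨hu, hu0, huu⟩, hx⟩ := h
    obtain ⟨hcU, hc1⟩ := hc u hu hu0
    simp only [Finset.coe_product, Set.mem_prod, Finset.mem_coe, mem_hyperbolicPairs,
      Finset.mem_univ, and_true]
    set x' := x - (B u x - 1) • c u with hx'
    have hx'U : x' ∈ U := U.sub_mem hx (U.smul_mem _ hcU)
    have hux' : B u x' = 1 := by simp [hx', hc1]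
    have hxu' : B x' u = 1 := by rw [← hux']; exact hB.eq _ _
    refine ⟨hu, U.sub_mem hx'U (U.smul_mem _ hu), huu, ?_, ?_⟩
    · simp [hux', hxu', huu]
      field_simp
      ring
    · simp [hux', huu]
  · rintro ⟨⟨u, w⟩, s, t⟩ h
    simp only [Finset.coe_product, Set.mem_prod, Finset.mem_coe, mem_hyperbolicPairs] at h
    obtain ⟨⟨hu, hw, huu, hww, huw⟩, -⟩ := h
    have hu0 : u ≠ 0 := by rintro rfl; simp at huw
    obtain ⟨hcU, hc1⟩ := hc u hu hu0
    have hwu : B w u = 1 := by rw [← huw]; exact hB.eq _ _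
    have ht : B u (w + s • u + t • c u) - 1 = t := by simp [huu, huw, hc1]
    have hx : w + s • u + t • c u - t • c u = w + s • u := by abel
    have hs : B (w + s • u) (w + s • u) / 2 = s := by
      simp [huu, hww, huw, hwu]
      field_simp
      ring
    simp only [ht, hx, hs, add_sub_cancel_right]
  · rintro ⟨u, x⟩ -
    simp

/-- The zeros of the form are split by whether `B u v` vanishes. Off `u⊥`, each line `v + F u`
contains exactly one zero; on `u⊥`, the form factors through `u⊥ / F u`, represented by the
orthogonal complement of `u, w`. The `+ 1` counts the zero vector. -/
theorem card_isotropicVectors_of_hyperbolic [Fintype F] (hB : B.IsSymm) (h2 : (2 : F) ≠ 0)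
    {u w : V} (hu : u ∈ U) (hw : w ∈ U) (huu : B u u = 0) (huw : B u w = 1) :
    Nat.card F ^ 2 * ((isotropicVectors B U).card + 1) + Nat.card F ^ finrank F U =
      Nat.card F * Nat.card F ^ finrank F U + Nat.card F ^ 3 * ((isotropicVectors B
        (U ⊓ B.orthogonal (Submodule.span F {u, w}))).card + 1) := by
  classical
  have hwu : B w u = 1 := by rw [← huw]; exact hB.eq _ _
  have hsymm : ∀ x y, B x y = B y x := fun x y => hB.eq x y
  have hZ : ∀ W : Submodule F V, ((Set.toFinite (W : Set V)).toFinset.filter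
      (fun v => B v v = 0)).card = (isotropicVectors B W).card + 1 := fun W => by
    have h0 : (0 : V) ∉ isotropicVectors B W := by simp
    rw [← Finset.card_insert_of_notMem h0]
    congr 1
    ext v
    by_cases hv : v = 0 <;> simp [hv]
  have hqc : Nat.card F = (Finset.univ : Finset F).card := by
    rw [Finset.card_univ, Nat.card_eq_fintype_card]
  set S := (Set.toFinite (U : Set V)).toFinset with hS
  set Z := S.filter (fun v => B v v = 0) with hZdef
  set N := S.filter (fun v => B u v = 0) with hN
  have e1 : (Z.filter (fun v => B u v = 0)).card + (Z.filter (fun v => ¬ B u v = 0)).card =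
      (isotropicVectors B U).card + 1 := by
    rw [← hZ U, Finset.card_filter_add_card_filter_not]
  have e2 : N.card + (S.filter (fun v => ¬ B u v = 0)).card = Nat.card F ^ finrank F U := by
    rw [← card_toFinset_submodule, Finset.card_filter_add_card_filter_not]
  have e3 : N.card * Nat.card F = Nat.card F ^ finrank F U := by
    rw [← card_toFinset_submodule, hqc, ← Finset.card_product]
    refine Finset.card_nbij' (fun x => x.1 + x.2 • w)
      (fun v => (v - B u v • w, B u v)) ?_ ?_ ?_ ?_
    · rintro ⟨v, t⟩ h
      have h : v ∈ U ∧ B u v = 0 := by simpa [hN, hS] using h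
      simpa using U.add_mem h.1 (U.smul_mem _ hw)
    · intro v h
      have h : v ∈ U := by simpa using h
      have h' := U.sub_mem h (U.smul_mem (B u v) hw)
      simp [hN, hS, huw, h']
    · rintro ⟨v, t⟩ h
      have h : v ∈ U ∧ B u v = 0 := by simpa [hN, hS] using h
      simp [h.2, huw]
    · intro v h
      simp
  -- Along `v + t • u` the form is affine in `t` with slope `2 * B u v ≠ 0`.
  have e4 : (Z.filter (fun v => ¬ B u v = 0)).card * Nat.card F =
      (S.filter (fun v => ¬ B u v = 0)).card := by
    rw [hqc, ← Finset.card_product]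
    refine Finset.card_nbij' (fun x => x.1 + x.2 • u)
      (fun v => (v - (B v v / (2 * B u v)) • u, B v v / (2 * B u v))) ?_ ?_ ?_ ?_
    · rintro ⟨v, t⟩ h
      have h : (v ∈ U ∧ B v v = 0) ∧ ¬ B u v = 0 := by simpa [hZdef, hS] using h
      have h' := U.add_mem h.1.1 (U.smul_mem t hu)
      simp [hS, h', huu, h.2]
    · intro v h
      have h : v ∈ U ∧ ¬ B u v = 0 := by simpa [hS] using h
      have h' := U.sub_mem h.1 (U.smul_mem (B v v / (2 * B u v)) hu)
      have h3 := h.2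
      simp only [Finset.coe_product, Set.mem_prod, Finset.mem_filter, hZdef, hS,
        Set.Finite.mem_toFinset, SetLike.mem_coe, h', true_and, Finset.mem_univ, and_true]
      refine ⟨?_, by simp [huu, h.2]⟩
      simp [huu, hsymm v u]
      field_simp
      ring
    · rintro ⟨v, t⟩ h
      have h : (v ∈ U ∧ B v v = 0) ∧ ¬ B u v = 0 := by simpa [hZdef, hS] using h
      have h3 := h.2
      have ht : B (v + t • u) (v + t • u) / (2 * B u (v + t • u)) = t := by
        simp [huu, hsymm v u, h.1.2]
        field_simp
        ring
      simp only [ht, add_sub_cancel_right]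
    · intro v h
      simp
  have e5 : (Z.filter (fun v => B u v = 0)).card = Nat.card F * ((isotropicVectors B
        (U ⊓ B.orthogonal (Submodule.span F {u, w}))).card + 1) := by
    rw [hqc, ← hZ, ← Finset.card_product]
    refine Finset.card_nbij' (fun v => (B w v, v - B w v • u)) (fun x => x.1 • u + x.2) ?_ ?_ ?_ ?_
    · intro v h
      have h : (v ∈ U ∧ B v v = 0) ∧ B u v = 0 := by simpa [hZdef, hS] using h
      have h' := U.sub_mem h.1.1 (U.smul_mem (B w v) hu)
      simp [h', mem_orthogonal_span_pair, huu, h, hsymm v u, hwu,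
        -LinearMap.BilinForm.mem_orthogonal_iff]
    · rintro ⟨t, v⟩ h
      have h : (v ∈ U ∧ B u v = 0 ∧ B w v = 0) ∧ B v v = 0 := by
        simpa [mem_orthogonal_span_pair,
          -LinearMap.BilinForm.mem_orthogonal_iff] using h
      have h' := U.add_mem (U.smul_mem t hu) h.1.1
      simp [hZdef, hS, h', h, huu, hsymm v u]
    · intro v h
      simp
    · rintro ⟨t, v⟩ h
      have h : (v ∈ U ∧ B u v = 0 ∧ B w v = 0) ∧ B v v = 0 := by
        simpa [mem_orthogonal_span_pair,
          -LinearMap.BilinForm.mem_orthogonal_iff] using h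
      simp [h, hwu]
  rw [← e1, e5]
  rw [← e4, ← e3] at e2
  rw [← e3]
  linear_combination (Nat.card F) * e2

/-- Chevalley: a subspace of dimension at least three has a nonzero isotropic vector. -/
theorem exists_isotropic_of_three_le_finrank [Fintype F] (hB : B.IsSymm) (h2 : (2 : F) ≠ 0)
    (h3 : 3 ≤ finrank F U) : (isotropicVectors B U).Nonempty := by
  by_contra hne
  have han : ∀ v ∈ U, v ≠ 0 → B v v ≠ 0 := fun v hv hv0 h0 =>
    hne ⟨v, mem_isotropicVectors.2 ⟨hv, hv0, h0⟩⟩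
  -- If `U` is anisotropic, any nonzero vector of a subspace splits off an orthogonal line, so three
  -- steps produce an orthogonal triple.
  have step : ∀ W : Submodule F V, W ≤ U → 1 ≤ finrank F W → ∃ v ∈ W, v ≠ 0 ∧
      finrank F W = finrank F ↥(W ⊓ B.orthogonal (F ∙ v)) + 1 := by
    intro W hW h1
    obtain ⟨v, hv, hv0⟩ := W.ne_bot_iff.1 (Submodule.one_le_finrank_iff.1 h1)
    refine ⟨v, hv, hv0, ?_⟩
    have := (isNonsingular_span_singleton (han v (hW hv) hv0)).finrank_inf_orthogonal hB
      (show F ∙ v ≤ W by simpa using hv)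
    rw [finrank_span_singleton hv0] at this
    omega
  have horth : ∀ {v x : V}, x ∈ B.orthogonal (F ∙ v) → B v x = 0 := fun hx =>
    hx _ (Submodule.mem_span_singleton_self _)
  obtain ⟨x, hx, hx0, hr1⟩ := step U le_rfl (by omega)
  obtain ⟨y, hy, hy0, hr2⟩ := step (U ⊓ B.orthogonal (F ∙ x)) inf_le_left (by omega)
  obtain ⟨z, hz, hz0, -⟩ := step _ (inf_le_left.trans inf_le_left)
    (show 1 ≤ finrank F ↥(U ⊓ B.orthogonal (F ∙ x) ⊓ B.orthogonal (F ∙ y)) by omega)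
  have hxy := horth hy.2
  have hxz := horth hz.1.2
  have hyz := horth hz.2
  have hyx : B y x = 0 := by rw [← hxy]; exact hB.eq _ _
  have hzx : B z x = 0 := by rw [← hxz]; exact hB.eq _ _
  have hzy : B z y = 0 := by rw [← hyz]; exact hB.eq _ _
  have hfx := han x hx hx0
  have hfy := han y hy.1 hy0
  have hfz := han z hz.1.1 hz0
  have hdx : (Polynomial.C (B x x) * Polynomial.X ^ 2 : Polynomial F).degree = 2 :=
    Polynomial.degree_C_mul_X_pow 2 hfx
  have hdy : (Polynomial.C (B y y) * Polynomial.X ^ 2 + Polynomial.C (B z z) :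
      Polynomial F).degree = 2 := by
    rw [Polynomial.degree_add_C] <;> rw [Polynomial.degree_C_mul_X_pow 2 hfy] <;> decide
  have hodd : Fintype.card F % 2 = 1 := FiniteField.odd_card_of_char_ne_two fun hc => h2 <| by
    have := ringChar.Nat.cast_ringChar (R := F)
    rw [hc] at this
    exact_mod_cast this
  -- Two quadratic polynomials over a finite field of odd order have values summing to zero
  -- somewhere: here this solves `a² B(x,x) + b² B(y,y) + B(z,z) = 0`.
  obtain ⟨a, b, hab⟩ := FiniteField.exists_root_sum_quadratic hdx hdy hodd
  simp at hab
  refine han (a • x + b • y + z) (U.add_mem (U.add_mem (U.smul_mem _ hx) (U.smul_mem _ hy.1))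
    hz.1.1) (fun h0 => hfz ?_) ?_
  · have := congrArg (B z) h0
    simpa [hzx, hzy] using this
  · simp [hxy, hxz, hyx, hyz, hzx, hzy]
    linear_combination hab

/-- The number of isotropic vectors of a nonsingular subspace. -/
theorem card_isotropicVectors [Fintype F] (hB : B.IsSymm) (h2 : (2 : F) ≠ 0)
    (hU : IsNonsingular B U) :
    (∀ n, finrank F U = 2 * n + 1 → Nat.card F * ((isotropicVectors B U).card + 1) =
      Nat.card F ^ (2 * n + 1)) ∧
    (∀ n, finrank F U = 2 * n → ∃ s : ℝ, (s = 1 ∨ s = -1) ∧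
      (Nat.card F * ((isotropicVectors B U).card + 1) : ℝ) =
      (Nat.card F : ℝ) ^ (2 * n) + s * (Nat.card F - 1) * (Nat.card F : ℝ) ^ n) := by
  induction hd : finrank F U using Nat.strong_induction_on generalizing U with
  | _ d ih =>
  have hq0 : 0 < Nat.card F := Nat.card_pos
  -- An isotropic vector allows a hyperbolic plane to be split off; the sign `s` passes unchanged
  -- from the complement to `U`.
  by_cases hne : (isotropicVectors B U).Nonempty
  · obtain ⟨u, hu⟩ := hne
    obtain ⟨hu, hu0, huu⟩ := mem_isotropicVectors.1 hu
    have hpos : 0 < (hyperbolicPairs B U).card := by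
      have := card_hyperbolicPairs hB h2 hU
      have h1 : 0 < (isotropicVectors B U).card * Nat.card F ^ finrank F U :=
        Nat.mul_pos (Finset.card_pos.2 ⟨u, mem_isotropicVectors.2 ⟨hu, hu0, huu⟩⟩) (by positivity)
      rw [← this] at h1
      exact Nat.pos_of_mul_pos_right h1
    obtain ⟨p, hp⟩ := Finset.card_pos.1 hpos
    obtain ⟨k1, k2, k3, k4, k5⟩ := mem_hyperbolicPairs.1 hp
    have hrec := card_isotropicVectors_of_hyperbolic hB h2 k1 k2 k3 k5
    have hA := isNonsingular_span_pair hB k3 k4 k5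
    have hAU : Submodule.span F {p.1, p.2} ≤ U := by
      simp [Submodule.span_le, Set.insert_subset_iff, k1, k2]
    have hr := hA.finrank_inf_orthogonal hB hAU
    rw [finrank_span_pair_of_hyperbolic hB k3 k4 k5] at hr
    obtain ⟨i1, i2⟩ := ih _ (by omega) (hA.inf_orthogonal hB hU hAU) rfl
    rw [hd] at hrec
    constructor
    · rintro n rfl
      obtain ⟨n, rfl⟩ : ∃ m, n = m + 1 := ⟨n - 1, by omega⟩
      have := i1 n (by omega)
      refine Nat.eq_of_mul_eq_mul_left hq0 ?_
      have h5 : Nat.card F ^ (2 * (n + 1) + 1) = Nat.card F ^ 2 * Nat.card F ^ (2 * n + 1) := by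
        ring
      rw [h5] at hrec ⊢
      linear_combination hrec + (Nat.card F) ^ 2 * this
    · rintro n rfl
      obtain ⟨n, rfl⟩ : ∃ m, n = m + 1 := ⟨n - 1, by omega⟩
      obtain ⟨s, hs, h⟩ := i2 n (by omega)
      refine ⟨s, hs, ?_⟩
      have hq0' : (Nat.card F : ℝ) ≠ 0 := by positivity
      have hrec' := congrArg (Nat.cast : ℕ → ℝ) hrec
      push_cast at hrec' h ⊢
      refine mul_left_cancel₀ hq0' ?_
      linear_combination hrec' + (Nat.card F : ℝ) ^ 2 * h
  · have hlt : finrank F U < 3 := by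
      by_contra h
      exact hne (exists_isotropic_of_three_le_finrank hB h2 (by omega))
    rw [Finset.not_nonempty_iff_eq_empty.1 hne]
    constructor
    · rintro n rfl
      obtain rfl : n = 0 := by omega
      simp
    · rintro n rfl
      obtain rfl | rfl : n = 0 ∨ n = 1 := by omega
      · exact ⟨1, Or.inl rfl, by simp⟩
      · exact ⟨-1, Or.inr rfl, by simp; ring⟩

end VectorCounts

/-! ### Gaussian binomials, the finite triple product and theta-weighted sums -/

section GaussianBinomial

/-- The finite Euler product `∏ (1 - t ^ i)` over `1 ≤ i ≤ n`. -/
noncomputable def eulerProd (t : ℝ) (n : ℕ) : ℝ := ∏ i ∈ Finset.range n, (1 - t ^ (i + 1))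

/-- The Gaussian binomial coefficient with parameter `t`. -/
noncomputable def gaussBinom (t : ℝ) : ℕ → ℕ → ℝ
  | _, 0 => 1
  | 0, _ + 1 => 0
  | n + 1, k + 1 => gaussBinom t n k + t ^ (k + 1) * gaussBinom t n (k + 1)

variable {t : ℝ}

@[simp] theorem gaussBinom_zero_right (t : ℝ) (n : ℕ) : gaussBinom t n 0 = 1 := by
  cases n <;> rfl

theorem gaussBinom_succ_succ (t : ℝ) (n k : ℕ) :
    gaussBinom t (n + 1) (k + 1) = gaussBinom t n k + t ^ (k + 1) * gaussBinom t n (k + 1) := rfl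

theorem gaussBinom_of_lt (t : ℝ) {n k : ℕ} (h : n < k) : gaussBinom t n k = 0 := by
  induction n generalizing k with
  | zero =>
    obtain ⟨k, rfl⟩ := Nat.exists_eq_succ_of_ne_zero h.ne'
    rfl
  | succ n ih =>
    obtain ⟨k, rfl⟩ := Nat.exists_eq_succ_of_ne_zero (Nat.ne_zero_of_lt h)
    rw [Nat.succ_eq_add_one, gaussBinom_succ_succ, ih (by omega), ih (by omega)]
    simp

@[simp] theorem gaussBinom_self (t : ℝ) (n : ℕ) : gaussBinom t n n = 1 := by
  induction n with
  | zero => rfl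
  | succ n ih => rw [gaussBinom_succ_succ, ih, gaussBinom_of_lt t n.lt_succ_self]; simp

@[simp] theorem eulerProd_zero (t : ℝ) : eulerProd t 0 = 1 := by simp [eulerProd]

theorem eulerProd_succ (t : ℝ) (n : ℕ) :
    eulerProd t (n + 1) = eulerProd t n * (1 - t ^ (n + 1)) := by
  simp [eulerProd, Finset.prod_range_succ]

/-- The product formula cleared of denominators, hence valid for all `t`; the Pascal rule calls for
induction on both `a` and `b`. -/
theorem gaussBinom_mul_eulerProd (t : ℝ) (a b : ℕ) :
    gaussBinom t (a + b) a * (eulerProd t a * eulerProd t b) = eulerProd t (a + b) := by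
  induction a generalizing b with
  | zero => simp
  | succ a iha =>
    induction b with
    | zero => simp
    | succ b ihb =>
      have h1 := iha (b + 1)
      have h2 : a + 1 + (b + 1) = (a + 1 + b) + 1 := by omega
      have h3 : a + (b + 1) = a + 1 + b := by omega
      rw [h3] at h1
      rw [h2, gaussBinom_succ_succ, eulerProd_succ t (a + 1 + b)]
      rw [eulerProd_succ t b] at h1 ⊢
      rw [eulerProd_succ t a] at ihb ⊢
      have h4 : a + 1 + b + 1 = (a + 1) + (b + 1) := by omega
      rw [h4, pow_add t (a + 1) (b + 1)]
      linear_combination (1 - t ^ (a + 1)) * h1 + t ^ (a + 1) * (1 - t ^ (b + 1)) * ihb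

theorem eulerProd_le_one (h0 : 0 ≤ t) (h1 : t ≤ 1) (n : ℕ) : eulerProd t n ≤ 1 :=
  Finset.prod_le_one (fun _ _ => sub_nonneg.2 (pow_le_one₀ h0 h1))
    fun _ _ => sub_le_self _ (pow_nonneg h0 _)

theorem half_le_eulerProd (h0 : 0 ≤ t) (h1 : t ≤ 1 / 3) (n : ℕ) : 1 / 2 ≤ eulerProd t n := by
  -- The extra `t ^ n / 2` makes the induction close: the step needs `3 * t ^ (n + 1) ≤ t ^ n`,
  -- which is `t ≤ 1 / 3`.
  suffices h : 1 / 2 + t ^ n / 2 ≤ eulerProd t n from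
    le_trans (le_add_of_nonneg_right (by positivity)) h
  induction n with
  | zero => norm_num
  | succ n ih =>
    have h2 := eulerProd_le_one h0 (h1.trans (by norm_num)) n
    have h3 : 0 ≤ t ^ n := by positivity
    have h5 : t ^ (n + 1) ≤ t ^ n / 3 := by rw [pow_succ]; nlinarith
    have h6 : 0 ≤ t ^ (n + 1) := by positivity
    rw [eulerProd_succ]
    nlinarith

theorem eulerProd_pos (h0 : 0 ≤ t) (h1 : t ≤ 1 / 3) (n : ℕ) : 0 < eulerProd t n :=
  lt_of_lt_of_le (by norm_num) (half_le_eulerProd h0 h1 n)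

theorem exists_tendsto_eulerProd (h0 : 0 ≤ t) (h1 : t ≤ 1 / 3) :
    ∃ L : ℝ, 0 < L ∧ Tendsto (eulerProd t) atTop (𝓝 L) := by
  have hanti : Antitone (eulerProd t) := antitone_nat_of_succ_le fun n => by
    rw [eulerProd_succ]
    have := pow_nonneg h0 (n + 1)
    exact mul_le_of_le_one_right (eulerProd_pos h0 h1 n).le (by linarith)
  have hbdd : BddBelow (Set.range (eulerProd t)) :=
    ⟨1 / 2, by rintro _ ⟨n, rfl⟩; exact half_le_eulerProd h0 h1 n⟩
  exact ⟨_, lt_of_lt_of_le (by norm_num) (le_ciInf (half_le_eulerProd h0 h1)),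
    tendsto_atTop_ciInf hanti hbdd⟩

theorem gaussBinom_eq_div (h0 : 0 ≤ t) (h1 : t ≤ 1 / 3) (a b : ℕ) :
    gaussBinom t (a + b) a = eulerProd t (a + b) / (eulerProd t a * eulerProd t b) := by
  have ha := eulerProd_pos h0 h1 a
  have hb := eulerProd_pos h0 h1 b
  rw [eq_div_iff (by positivity), gaussBinom_mul_eulerProd]

theorem gaussBinom_symm (h0 : 0 ≤ t) (h1 : t ≤ 1 / 3) (a b : ℕ) :
    gaussBinom t (a + b) a = gaussBinom t (a + b) b := by
  rw [gaussBinom_eq_div h0 h1, add_comm a b, gaussBinom_eq_div h0 h1, mul_comm]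

theorem gaussBinom_nonneg (h0 : 0 ≤ t) (n k : ℕ) : 0 ≤ gaussBinom t n k := by
  induction n generalizing k with
  | zero => cases k <;> simp [gaussBinom]
  | succ n ih =>
    cases k with
    | zero => simp
    | succ k =>
      rw [gaussBinom_succ_succ]
      have := ih k
      have := ih (k + 1)
      positivity

theorem gaussBinom_le_four (h0 : 0 ≤ t) (h1 : t ≤ 1 / 3) (n k : ℕ) : gaussBinom t n k ≤ 4 := by
  rcases lt_or_ge n k with h | h
  · rw [gaussBinom_of_lt t h]; norm_num
  · obtain ⟨b, rfl⟩ := Nat.exists_eq_add_of_le h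
    have ha := eulerProd_pos h0 h1 k
    have hb := eulerProd_pos h0 h1 b
    have ha' := half_le_eulerProd h0 h1 k
    have hb' := half_le_eulerProd h0 h1 b
    rw [gaussBinom_eq_div h0 h1, div_le_iff₀ (by positivity)]
    refine (eulerProd_le_one h0 (h1.trans (by norm_num)) _).trans ?_
    nlinarith

theorem gaussBinom_succ_succ_mul (h0 : 0 ≤ t) (h1 : t ≤ 1 / 3) {n k : ℕ} (hk : k ≤ n) :
    gaussBinom t (n + 1) (k + 1) * (1 - t ^ (k + 1)) = (1 - t ^ (n + 1)) * gaussBinom t n k := by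
  obtain ⟨b, rfl⟩ := Nat.exists_eq_add_of_le hk
  have ha := eulerProd_pos h0 h1 k
  have hb := eulerProd_pos h0 h1 b
  have e1 := gaussBinom_mul_eulerProd t (k + 1) b
  have e2 := gaussBinom_mul_eulerProd t k b
  rw [show k + 1 + b = k + b + 1 by omega, eulerProd_succ, eulerProd_succ] at e1
  refine mul_right_cancel₀ (mul_pos ha hb).ne' ?_
  linear_combination e1 - (1 - t ^ (k + b + 1)) * e2

/-- The second Pascal rule, obtained by comparing the first with the absorption identity
`gaussBinom_succ_succ_mul`; a factor `t ^ (a + 1)` is cancelled, hence `0 < t`. -/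
theorem gaussBinom_succ_succ' (h0 : 0 < t) (h1 : t ≤ 1 / 3) (a b : ℕ) :
    gaussBinom t (a + b + 1) (a + 1) =
      t ^ b * gaussBinom t (a + b) a + gaussBinom t (a + b) (a + 1) := by
  have e1 := gaussBinom_succ_succ_mul h0.le h1 (Nat.le_add_right a b)
  have e4 : t ^ (a + b + 1) = t ^ (a + 1) * t ^ b := by ring
  rw [e4] at e1
  rw [gaussBinom_succ_succ] at e1 ⊢
  refine mul_left_cancel₀ (pow_pos h0 (a + 1)).ne' ?_
  linear_combination -e1

/-- All three Euler products in the quotient formula tend to `L`, and `L / (L * L) = L⁻¹`. -/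
theorem tendsto_gaussBinom (h0 : 0 ≤ t) (h1 : t ≤ 1 / 3) {L : ℝ} (hL : 0 < L)
    (h : Tendsto (eulerProd t) atTop (𝓝 L)) {a b : ℕ → ℕ} (ha : Tendsto a atTop atTop)
    (hb : Tendsto b atTop atTop) :
    Tendsto (fun n => gaussBinom t (a n + b n) (a n)) atTop (𝓝 L⁻¹) := by
  simp_rw [gaussBinom_eq_div h0 h1]
  have hab : Tendsto (fun n => a n + b n) atTop atTop :=
    tendsto_atTop_mono (fun n => Nat.le_add_right _ _) ha
  have := (h.comp hab).div ((h.comp ha).mul (h.comp hb)) (mul_pos hL hL).ne'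
  rwa [div_mul_cancel_left₀ hL.ne'] at this

/-- The theta-like sum of the finite Jacobi triple product identity. -/
noncomputable def thetaSum (y : ℝ) (N M : ℕ) : ℝ :=
  ∑ k ∈ Finset.range (N + M + 1), y ^ (((k : ℤ) - N) ^ 2) * gaussBinom (y ^ 2) (N + M) k

/-- The second Pascal rule splits the sum into two copies of the old one; the exponents match
because `(k+1-N)² + 2b = (2M+1) + (k-N)²` when `k + b = N + M`. -/
theorem thetaSum_succ_right {y : ℝ} (hy : 0 < y) (h1 : y ^ 2 ≤ 1 / 3) (N M : ℕ) :
    thetaSum y N (M + 1) = (1 + y ^ (2 * M + 1)) * thetaSum y N M := by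
  have key : ∀ k ∈ Finset.range (N + M + 1),
      y ^ (((k + 1 : ℕ) : ℤ) - N) ^ 2 * gaussBinom (y ^ 2) (N + M + 1) (k + 1) =
      y ^ (2 * M + 1) * (y ^ ((k : ℤ) - N) ^ 2 * gaussBinom (y ^ 2) (N + M) k) +
        y ^ (((k + 1 : ℕ) : ℤ) - N) ^ 2 * gaussBinom (y ^ 2) (N + M) (k + 1) := by
    intro k hk
    obtain ⟨b, hb⟩ := Nat.exists_eq_add_of_le (Nat.lt_succ_iff.1 (Finset.mem_range.1 hk))
    have he : y ^ (((k + 1 : ℕ) : ℤ) - N) ^ 2 * (y ^ 2) ^ b =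
        y ^ (2 * M + 1) * y ^ ((k : ℤ) - N) ^ 2 := by
      rw [← pow_mul, ← zpow_natCast, ← zpow_natCast, ← zpow_add₀ hy.ne', ← zpow_add₀ hy.ne']
      congr 1
      have : (N : ℤ) + M = k + b := by exact_mod_cast hb
      push_cast
      linear_combination (-2) * this
    rw [hb, gaussBinom_succ_succ' (by positivity) h1]
    linear_combination gaussBinom (y ^ 2) (k + b) k * he
  -- The old sum with one more, vanishing, term at the top and its bottom term separated: this is
  -- the shifted copy.
  have e2 := Finset.sum_range_succ' (fun k : ℕ => y ^ ((k : ℤ) - N) ^ 2 *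
    gaussBinom (y ^ 2) (N + M) k) (N + M + 1)
  rw [Finset.sum_range_succ, gaussBinom_of_lt _ (Nat.lt_succ_self _), mul_zero, add_zero] at e2
  unfold thetaSum
  rw [show N + (M + 1) = N + M + 1 by omega, Finset.sum_range_succ', Finset.sum_congr rfl key,
    Finset.sum_add_distrib, ← Finset.mul_sum, add_mul, one_mul, gaussBinom_zero_right]
  rw [gaussBinom_zero_right] at e2
  linear_combination -e2

/-- As for `thetaSum_succ_right`, now with the first Pascal rule and `(k-N-1)² + 2k = (2N+1) +
(k-N)²`. -/
theorem thetaSum_succ_left {y : ℝ} (hy : 0 < y) (N M : ℕ) :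
    thetaSum y (N + 1) M = (1 + y ^ (2 * N + 1)) * thetaSum y N M := by
  have he : ∀ k : ℕ, y ^ ((k : ℤ) - (N + 1 : ℕ)) ^ 2 * (y ^ 2) ^ k =
      y ^ (2 * N + 1) * y ^ ((k : ℤ) - N) ^ 2 := by
    intro k
    rw [← pow_mul, ← zpow_natCast, ← zpow_natCast, ← zpow_add₀ hy.ne', ← zpow_add₀ hy.ne']
    congr 1
    push_cast
    ring
  have key : ∀ k ∈ Finset.range (N + M + 1),
      y ^ (((k + 1 : ℕ) : ℤ) - (N + 1 : ℕ)) ^ 2 * gaussBinom (y ^ 2) (N + M + 1) (k + 1) =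
      y ^ ((k : ℤ) - N) ^ 2 * gaussBinom (y ^ 2) (N + M) k +
        y ^ (2 * N + 1) * (y ^ (((k + 1 : ℕ) : ℤ) - N) ^ 2 *
          gaussBinom (y ^ 2) (N + M) (k + 1)) := by
    intro k hk
    have h3 : ((k + 1 : ℕ) : ℤ) - (N + 1 : ℕ) = k - N := by push_cast; ring
    have h4 := he (k + 1)
    rw [h3] at h4 ⊢
    rw [gaussBinom_succ_succ]
    linear_combination gaussBinom (y ^ 2) (N + M) (k + 1) * h4
  have e2 := Finset.sum_range_succ' (fun k : ℕ => y ^ ((k : ℤ) - N) ^ 2 *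
    gaussBinom (y ^ 2) (N + M) k) (N + M + 1)
  rw [Finset.sum_range_succ, gaussBinom_of_lt _ (Nat.lt_succ_self _), mul_zero, add_zero] at e2
  unfold thetaSum
  rw [show N + 1 + M = N + M + 1 by omega, Finset.sum_range_succ', Finset.sum_congr rfl key,
    Finset.sum_add_distrib, ← Finset.mul_sum, add_mul, one_mul, gaussBinom_zero_right]
  rw [gaussBinom_zero_right] at e2
  have h0 := he 0
  linear_combination h0 - y ^ (2 * N + 1) * e2

/-- The finite Jacobi triple product identity. -/
theorem thetaSum_self {y : ℝ} (hy : 0 < y) (h1 : y ^ 2 ≤ 1 / 3) (n : ℕ) :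
    thetaSum y n n = ∏ i ∈ Finset.range n, (1 + y ^ (2 * i + 1)) ^ 2 := by
  induction n with
  | zero => simp [thetaSum]
  | succ n ih =>
    rw [thetaSum_succ_right hy h1, thetaSum_succ_left hy, ih, Finset.prod_range_succ]
    ring

theorem summable_pow_sq {y : ℝ} (hy : 0 < y) (hy1 : y < 1) :
    Summable fun j : ℤ => y ^ (j ^ 2) := by
  have h : Summable fun n : ℕ => y ^ ((n : ℤ) ^ 2) := by
    refine (summable_geometric_of_lt_one hy.le hy1).of_nonneg_of_le
      (fun n => by positivity) fun n => ?_
    rw [← Nat.cast_pow, zpow_natCast]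
    exact pow_le_pow_of_le_one hy.le hy1.le (Nat.le_self_pow two_ne_zero n)
  exact Summable.of_nat_of_neg h (by simpa using h)

/-- Centring at `j = k - n` and extending by zero to all `j : ℤ` gives series dominated by `C * y ^
(j ^ 2)`, so termwise convergence suffices. -/
theorem tendsto_sum_pow_sq_mul {y : ℝ} (hy : 0 < y) (hy1 : y < 1) {δ : ℕ → ℕ → ℝ} {C : ℝ}
    (hC : ∀ n k, k ≤ 2 * n → |δ n k| ≤ C)
    (hδ : ∀ j : ℤ, Tendsto (fun n : ℕ => δ n (n + j).toNat) atTop (𝓝 0)) :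
    Tendsto (fun n : ℕ => ∑ k ∈ Finset.range (2 * n + 1), y ^ (((k : ℤ) - n) ^ 2) * δ n k)
      atTop (𝓝 0) := by
  have hsum : ∀ n : ℕ, ∑ k ∈ Finset.range (2 * n + 1), y ^ (((k : ℤ) - n) ^ 2) * δ n k =
      ∑' j : ℤ, if j ∈ Finset.Icc (-n : ℤ) n then y ^ (j ^ 2) * δ n (n + j).toNat else 0 := by
    intro n
    rw [tsum_eq_sum (s := Finset.Icc (-n : ℤ) n) fun j hj => if_neg hj]
    refine Finset.sum_bij' (fun k _ => (k : ℤ) - n) (fun j _ => (n + j).toNat) ?_ ?_ ?_ ?_ ?_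
    · intro k hk
      simp only [Finset.mem_range, Finset.mem_Icc] at hk ⊢
      omega
    · intro j hj
      simp only [Finset.mem_range, Finset.mem_Icc] at hj ⊢
      omega
    · intro k hk
      simp
    · intro j hj
      simp only [Finset.mem_Icc] at hj
      omega
    · intro k hk
      simp only [Finset.mem_range] at hk
      rw [if_pos (by rw [Finset.mem_Icc]; omega)]
      simp
  simp_rw [hsum]
  have hC0 : 0 ≤ C := (abs_nonneg _).trans (hC 0 0 le_rfl)
  have := tendsto_tsum_of_dominated_convergence (𝓕 := atTop) (g := fun _ : ℤ => (0 : ℝ))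
    (f := fun (n : ℕ) (j : ℤ) =>
      if j ∈ Finset.Icc (-n : ℤ) n then y ^ (j ^ 2) * δ n (n + j).toNat else 0)
    (bound := fun j => y ^ (j ^ 2) * C) ((summable_pow_sq hy hy1).mul_right C) ?_ ?_
  · simpa using this
  · intro j
    have h := (hδ j).const_mul (y ^ (j ^ 2))
    rw [mul_zero] at h
    refine h.congr' ?_
    filter_upwards [eventually_ge_atTop j.natAbs] with n hn
    rw [if_pos (by rw [Finset.mem_Icc]; omega)]
  · refine Eventually.of_forall fun n j => ?_
    have hyp : 0 < y ^ (j ^ 2) := zpow_pos hy _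
    split_ifs with hj
    · rw [Finset.mem_Icc] at hj
      rw [Real.norm_eq_abs, abs_mul, abs_of_pos hyp]
      exact mul_le_mul_of_nonneg_left (hC n _ (by omega)) hyp.le
    · rw [norm_zero]
      positivity

end GaussianBinomial

/-! ### Numbers of nonsingular subspaces by parity of the dimensions -/

section SubspaceCounts

theorem three_le_natCard_of_two_ne_zero {F : Type*} [Field F] [Fintype F] (h2 : (2 : F) ≠ 0) :
    3 ≤ Nat.card F := by
  rw [Nat.card_eq_fintype_card]
  have hodd : Fintype.card F % 2 = 1 := FiniteField.odd_card_of_char_ne_two fun hc => h2 <| by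
    have := ringChar.Nat.cast_ringChar (R := F)
    rw [hc] at this
    exact_mod_cast this
  have : 1 < Fintype.card F := Fintype.one_lt_card
  omega

theorem pow_sub_one_eq_mul_one_sub {q : ℝ} (hq : q ≠ 0) (m : ℕ) :
    q ^ (2 * m) - 1 = q ^ (2 * m) * (1 - (q⁻¹ ^ 2) ^ m) := by
  rw [← pow_mul, mul_sub, ← mul_pow, mul_inv_cancel₀ hq, one_pow, mul_one]

variable {F V : Type*} [Field F] [AddCommGroup V] [Module F V] [Finite V]
  {B : BilinForm F V} {U : Submodule F V}

theorem finrank_inf_orthogonal_anisotropic (hB : B.IsSymm) (hU : IsNonsingular B U) {v : V}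
    (hv : v ∈ anisotropicVectors B U) :
    IsNonsingular B (U ⊓ B.orthogonal (F ∙ v)) ∧
      finrank F ↥(U ⊓ B.orthogonal (F ∙ v)) + 1 = finrank F U := by
  rw [mem_anisotropicVectors] at hv
  have hA := isNonsingular_span_singleton hv.2
  have hAU : F ∙ v ≤ U := by simpa using hv.1
  have hr := hA.finrank_inf_orthogonal hB hAU
  rw [finrank_span_singleton (by rintro rfl; simp at hv)] at hr
  exact ⟨hA.inf_orthogonal hB hU hAU, by omega⟩

theorem finrank_inf_orthogonal_hyperbolic (hB : B.IsSymm) (hU : IsNonsingular B U) {p : V × V}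
    (hp : p ∈ hyperbolicPairs B U) :
    IsNonsingular B (U ⊓ B.orthogonal (Submodule.span F {p.1, p.2})) ∧
      finrank F ↥(U ⊓ B.orthogonal (Submodule.span F {p.1, p.2})) + 2 = finrank F U := by
  obtain ⟨h1, h2, h3, h4, h5⟩ := mem_hyperbolicPairs.1 hp
  have hA := isNonsingular_span_pair hB h3 h4 h5
  have hAU : Submodule.span F {p.1, p.2} ≤ U := by
    simp [Submodule.span_le, Set.insert_subset_iff, h1, h2]
  have hr := hA.finrank_inf_orthogonal hB hAU
  rw [finrank_span_pair_of_hyperbolic hB h3 h4 h5] at hr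
  exact ⟨hA.inf_orthogonal hB hU hAU, by omega⟩

/-- Double counting of pairs `v ∈ W` with `v` anisotropic, when the number of nonsingular
subspaces of all `U ⊓ v⊥` is the same. -/
theorem sum_card_anisotropicVectors_of_forall (hB : B.IsSymm) (hU : IsNonsingular B U)
    {d k : ℕ} (hd : finrank F U = d + 1) {c : ℝ}
    (hc : ∀ U' : Submodule F V, IsNonsingular B U' → finrank F U' = d →
      ((nonsingularSubspaces B U' k).card : ℝ) = c) :
    ∑ W ∈ nonsingularSubspaces B U (k + 1), ((anisotropicVectors B W).card : ℝ) =
      (anisotropicVectors B U).card * c := by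
  have h := congrArg (Nat.cast : ℕ → ℝ) (sum_card_anisotropicVectors (U := U) hB k)
  push_cast at h
  rw [h, Finset.sum_congr rfl (g := fun _ => c), Finset.sum_const, nsmul_eq_mul]
  intro v hv
  obtain ⟨h1, h2⟩ := finrank_inf_orthogonal_anisotropic hB hU hv
  exact hc _ h1 (by omega)

/-- Double counting of pairs `p ⊆ W` with `p` a hyperbolic pair, when the number of nonsingular
subspaces of all `U ⊓ p⊥` is the same. -/
theorem sum_card_hyperbolicPairs_of_forall (hB : B.IsSymm) (hU : IsNonsingular B U)
    {d k : ℕ} (hd : finrank F U = d + 2) {c : ℝ}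
    (hc : ∀ U' : Submodule F V, IsNonsingular B U' → finrank F U' = d →
      ((nonsingularSubspaces B U' k).card : ℝ) = c) :
    ∑ W ∈ nonsingularSubspaces B U (k + 2), ((hyperbolicPairs B W).card : ℝ) =
      (hyperbolicPairs B U).card * c := by
  have h := congrArg (Nat.cast : ℕ → ℝ) (sum_card_hyperbolicPairs (U := U) hB k)
  push_cast at h
  rw [h, Finset.sum_congr rfl (g := fun _ => c), Finset.sum_const, nsmul_eq_mul]
  intro v hv
  obtain ⟨h1, h2⟩ := finrank_inf_orthogonal_hyperbolic hB hU hv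
  exact hc _ h1 (by omega)

variable [Fintype F]

theorem inv_sq_card_le (h2 : (2 : F) ≠ 0) : ((Nat.card F : ℝ)⁻¹) ^ 2 ≤ 1 / 3 := by
  have h3 : (3 : ℝ) ≤ Nat.card F := by exact_mod_cast three_le_natCard_of_two_ne_zero h2
  have h4 : (Nat.card F : ℝ)⁻¹ ≤ 3⁻¹ := inv_anti₀ (by norm_num) h3
  have h5 : 0 ≤ (Nat.card F : ℝ)⁻¹ := by positivity
  nlinarith

theorem card_isotropicVectors_odd (hB : B.IsSymm) (h2 : (2 : F) ≠ 0) (hU : IsNonsingular B U)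
    {n : ℕ} (hn : finrank F U = 2 * n + 1) :
    ((isotropicVectors B U).card : ℝ) = (Nat.card F : ℝ) ^ (2 * n) - 1 := by
  have hq : (Nat.card F : ℝ) ≠ 0 := by exact_mod_cast Nat.card_pos.ne'
  have h := congrArg (Nat.cast : ℕ → ℝ) ((card_isotropicVectors hB h2 hU).1 n hn)
  push_cast at h
  refine mul_left_cancel₀ hq ?_
  linear_combination h

theorem card_hyperbolicPairs_odd (hB : B.IsSymm) (h2 : (2 : F) ≠ 0) (hU : IsNonsingular B U)
    {n : ℕ} (hn : finrank F U = 2 * (n + 1) + 1) :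
    ((hyperbolicPairs B U).card : ℝ) =
      ((Nat.card F : ℝ) ^ (2 * (n + 1)) - 1) * (Nat.card F : ℝ) ^ (2 * n + 1) := by
  have hq : (Nat.card F : ℝ) ^ 2 ≠ 0 := pow_ne_zero _ (by exact_mod_cast Nat.card_pos.ne')
  have h := congrArg (Nat.cast : ℕ → ℝ) (card_hyperbolicPairs hB h2 hU)
  push_cast at h
  rw [card_isotropicVectors_odd hB h2 hU hn, hn] at h
  refine mul_right_cancel₀ hq ?_
  linear_combination h

theorem card_anisotropicVectors_odd (hB : B.IsSymm) (h2 : (2 : F) ≠ 0)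
    (hU : IsNonsingular B U) {n : ℕ} (hn : finrank F U = 2 * n + 1) :
    ((anisotropicVectors B U).card : ℝ) =
      (Nat.card F - 1) * (Nat.card F : ℝ) ^ (2 * n) := by
  have h := congrArg (Nat.cast : ℕ → ℝ)
    (card_isotropicVectors_add_card_anisotropicVectors (B := B) (U := U))
  push_cast at h
  rw [card_isotropicVectors_odd hB h2 hU hn, hn] at h
  linear_combination h

/-- The constant is `c = 1 - s * q⁻¹ ^ (n + 1)`, with `s` the sign from `card_isotropicVectors`: the
type is a relative error of this size. -/
theorem exists_card_anisotropicVectors_even (hB : B.IsSymm) (h2 : (2 : F) ≠ 0)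
    (hU : IsNonsingular B U) {n : ℕ} (hn : finrank F U = 2 * (n + 1)) :
    ∃ c : ℝ, |c - 1| ≤ (Nat.card F : ℝ)⁻¹ ^ (n + 1) ∧ ((anisotropicVectors B U).card : ℝ) =
      (Nat.card F - 1) * (Nat.card F : ℝ) ^ (2 * n + 1) * c := by
  have hq : (Nat.card F : ℝ) ≠ 0 := by exact_mod_cast Nat.card_pos.ne'
  obtain ⟨s, hs, h1⟩ := (card_isotropicVectors hB h2 hU).2 (n + 1) hn
  have h := congrArg (Nat.cast : ℕ → ℝ)
    (card_isotropicVectors_add_card_anisotropicVectors (B := B) (U := U))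
  push_cast at h
  rw [hn] at h
  refine ⟨1 - s * (Nat.card F : ℝ)⁻¹ ^ (n + 1), ?_, ?_⟩
  · have hs' : |s| = 1 := by rcases hs with rfl | rfl <;> simp
    rw [sub_sub_cancel_left, abs_neg, abs_mul, hs', one_mul, abs_of_nonneg (by positivity)]
  · have h3 : (Nat.card F : ℝ) ^ (n + 1) * (Nat.card F : ℝ)⁻¹ ^ (n + 1) = 1 := by
      rw [← mul_pow, mul_inv_cancel₀ hq, one_pow]
    refine mul_left_cancel₀ hq ?_
    linear_combination (Nat.card F : ℝ) * h - h1 +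
      s * (Nat.card F - 1) * (Nat.card F : ℝ) ^ (n + 1) * h3

/-- In odd dimension the number of hyperbolic pairs depends on the dimension alone, so double
counting them gives a recursion lowering `m` by one with `b` fixed. -/
theorem card_nonsingularSubspaces_odd_odd (hB : B.IsSymm) (h2 : (2 : F) ≠ 0)
    (hU : IsNonsingular B U) (m b : ℕ) (hd : finrank F U = 2 * (m + b) + 1) :
    ((nonsingularSubspaces B U (2 * m + 1)).card : ℝ) = (Nat.card F : ℝ) ^ ((2 * m + 1) * (2 * b))
      * gaussBinom ((Nat.card F : ℝ)⁻¹ ^ 2) (m + b) m := by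
  have ht := inv_sq_card_le h2
  have hq3 : (3 : ℝ) ≤ Nat.card F := by exact_mod_cast three_le_natCard_of_two_ne_zero h2
  induction m generalizing U with
  | zero =>
    -- For lines, anisotropic vectors are counted instead: each nonsingular line contains `q - 1` of
    -- them.
    have h := sum_card_anisotropicVectors_of_forall hB hU (k := 0) hd (c := 1) fun U' _ _ => by
      rw [card_nonsingularSubspaces_zero, Nat.cast_one]
    rw [Finset.sum_congr rfl (g := fun _ => (Nat.card F : ℝ) - 1), Finset.sum_const,
      nsmul_eq_mul, card_anisotropicVectors_odd hB h2 hU hd] at h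
    · have hq1 : (Nat.card F : ℝ) - 1 ≠ 0 := by linarith
      refine mul_right_cancel₀ hq1 ?_
      simp only [gaussBinom_zero_right]
      rw [zero_add] at h
      linear_combination h
    · intro W hW
      obtain ⟨-, h3, h4⟩ := mem_nonsingularSubspaces.1 hW
      rw [card_anisotropicVectors_odd hB h2 h3 (n := 0) (by omega)]
      simp
  | succ m ih =>
    set q : ℝ := (Nat.card F : ℝ) with hq
    have hq0 : q ≠ 0 := by linarith
    have h := sum_card_hyperbolicPairs_of_forall hB hU (d := 2 * (m + b) + 1) (k := 2 * m + 1)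
      (by omega) fun U' h3 h4 => ih h3 h4
    rw [Finset.sum_congr rfl (g := fun _ => (q ^ (2 * (m + 1)) - 1) * q ^ (2 * m + 1)),
      Finset.sum_const, nsmul_eq_mul, card_hyperbolicPairs_odd hB h2 hU (n := m + b) (by omega),
      ← hq, pow_sub_one_eq_mul_one_sub hq0, pow_sub_one_eq_mul_one_sub hq0] at h
    · have hg := gaussBinom_succ_succ_mul (t := q⁻¹ ^ 2) (by positivity) ht (Nat.le_add_right m b)
      have hlt : (q⁻¹ ^ 2) ^ (m + 1) < 1 :=
        pow_lt_one₀ (by positivity) (by linarith) (by omega)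
      have hne : q ^ (2 * (m + 1)) * (1 - (q⁻¹ ^ 2) ^ (m + 1)) * q ^ (2 * m + 1) ≠ 0 := by
        have : 1 - (q⁻¹ ^ 2) ^ (m + 1) ≠ 0 := by linarith
        positivity
      refine mul_right_cancel₀ hne ?_
      rw [show m + 1 + b = m + b + 1 by omega]
      have e : 2 * (m + 1) + 1 = 2 * m + 1 + 2 := by omega
      rw [e, h]
      have e2 : q ^ (2 * (m + b + 1)) * q ^ (2 * (m + b) + 1) * q ^ ((2 * m + 1) * (2 * b)) =
          q ^ ((2 * m + 1 + 2) * (2 * b)) * q ^ (2 * (m + 1)) * q ^ (2 * m + 1) := by ring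
      linear_combination (1 - (q⁻¹ ^ 2) ^ (m + b + 1)) * gaussBinom (q⁻¹ ^ 2) (m + b) m * e2 -
        q ^ ((2 * m + 1 + 2) * (2 * b)) * q ^ (2 * (m + 1)) * q ^ (2 * m + 1) * hg
    · intro W hW
      obtain ⟨-, h3, h4⟩ := mem_nonsingularSubspaces.1 hW
      exact card_hyperbolicPairs_odd hB h2 h3 (by omega)

theorem card_nonsingularSubspaces_even_odd (hB : B.IsSymm) (h2 : (2 : F) ≠ 0)
    (hU : IsNonsingular B U) (m b : ℕ) (hd : finrank F U = 2 * (m + b) + 1) :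
    ((nonsingularSubspaces B U (2 * m)).card : ℝ) = (Nat.card F : ℝ) ^ (2 * m * (2 * b + 1))
      * gaussBinom ((Nat.card F : ℝ)⁻¹ ^ 2) (m + b) m := by
  rw [card_nonsingularSubspaces_complement hB hU (l := 2 * b + 1) (by omega),
    card_nonsingularSubspaces_odd_odd hB h2 hU b m (by omega), add_comm b m,
    gaussBinom_symm (by positivity) (inv_sq_card_le h2) m b, mul_comm (2 * m)]

/-- Pairs of an anisotropic `v` and an odd-dimensional `W ∋ v` are counted: `U ∩ v⊥` has odd
dimension, where the counts are known. The type of `U` enters only through its number of anisotropic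
vectors, so one `c` serves all `m`. -/
theorem card_nonsingularSubspaces_odd_even (hB : B.IsSymm) (h2 : (2 : F) ≠ 0)
    (hU : IsNonsingular B U) {n : ℕ} (hd : finrank F U = 2 * (n + 1)) :
    ∃ c : ℝ, |c - 1| ≤ (Nat.card F : ℝ)⁻¹ ^ (n + 1) ∧ ∀ m b : ℕ, m + b = n →
      ((nonsingularSubspaces B U (2 * m + 1)).card : ℝ) =
        (Nat.card F : ℝ) ^ ((2 * m + 1) * (2 * b + 1)) *
          (c * gaussBinom ((Nat.card F : ℝ)⁻¹ ^ 2) n m) := by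
  have hq3 : (3 : ℝ) ≤ Nat.card F := by exact_mod_cast three_le_natCard_of_two_ne_zero h2
  obtain ⟨c, hc, han⟩ := exists_card_anisotropicVectors_even hB h2 hU hd
  refine ⟨c, hc, ?_⟩
  rintro m b rfl
  set q : ℝ := (Nat.card F : ℝ) with hq
  have h := sum_card_anisotropicVectors_of_forall hB hU (d := 2 * (m + b) + 1) (k := 2 * m)
    (by omega) fun U' h3 h4 => card_nonsingularSubspaces_even_odd hB h2 h3 m b h4
  rw [Finset.sum_congr rfl (g := fun _ => (q - 1) * q ^ (2 * m)), Finset.sum_const,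
    nsmul_eq_mul, han, ← hq] at h
  · have hne : (q - 1) * q ^ (2 * m) ≠ 0 :=
      mul_ne_zero (by linarith) (pow_ne_zero _ (by linarith))
    refine mul_right_cancel₀ hne (h.trans ?_)
    ring
  · intro W hW
    obtain ⟨-, h3, h4⟩ := mem_nonsingularSubspaces.1 hW
    exact card_anisotropicVectors_odd hB h2 h3 h4

/-- Subspaces `W` of both types occur, so neither vector count is constant in `W`. But the total
numbers of isotropic and of anisotropic vectors over all `W` are the same multiple of those in `U`;
on adding, both types disappear, since each space has `q ^ dim - 1` nonzero vectors. -/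
theorem card_nonsingularSubspaces_even_even (hB : B.IsSymm) (h2 : (2 : F) ≠ 0)
    (hU : IsNonsingular B U) (m b : ℕ) (hd : finrank F U = 2 * (m + b)) :
    ((nonsingularSubspaces B U (2 * m)).card : ℝ) = (Nat.card F : ℝ) ^ (2 * m * (2 * b))
      * gaussBinom ((Nat.card F : ℝ)⁻¹ ^ 2) (m + b) m := by
  have ht := inv_sq_card_le h2
  have hq3 : (3 : ℝ) ≤ Nat.card F := by exact_mod_cast three_le_natCard_of_two_ne_zero h2
  induction m generalizing U with
  | zero => simp [card_nonsingularSubspaces_zero]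
  | succ m ih =>
    set q : ℝ := (Nat.card F : ℝ) with hq
    have hq0 : q ≠ 0 := by linarith
    set g := gaussBinom (q⁻¹ ^ 2) (m + b) m with hgdef
    have hcard : ∀ W : Submodule F V, ((isotropicVectors B W).card : ℝ) +
        (anisotropicVectors B W).card = q ^ finrank F W - 1 := fun W => by
      have := congrArg (Nat.cast : ℕ → ℝ)
        (card_isotropicVectors_add_card_anisotropicVectors (B := B) (U := W))
      push_cast at this
      linear_combination this
    have hhyp : ∀ W : Submodule F V, IsNonsingular B W → ((hyperbolicPairs B W).card : ℝ) * q ^ 2 =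
        (isotropicVectors B W).card * q ^ finrank F W := fun W hW => by
      have := congrArg (Nat.cast : ℕ → ℝ) (card_hyperbolicPairs hB h2 hW)
      push_cast at this
      exact this
    have h1 := sum_card_hyperbolicPairs_of_forall hB hU (d := 2 * (m + b)) (k := 2 * m)
      (by omega) fun U' h3 h4 => ih h3 h4
    have h3 := sum_card_anisotropicVectors_of_forall hB hU (d := 2 * (m + b) + 1)
      (k := 2 * m + 1) (by omega)
      fun U' h3 h4 => card_nonsingularSubspaces_odd_odd hB h2 h3 m b h4
    rw [← hq, ← hgdef] at h3
    have hN : ∀ W ∈ nonsingularSubspaces B U (2 * m + 2), ((isotropicVectors B W).card : ℝ) =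
        q ^ (2 * m + 2) - 1 - (anisotropicVectors B W).card := fun W hW => by
      rw [← (mem_nonsingularSubspaces.1 hW).2.2, ← hcard]
      ring
    -- Hyperbolic pairs are converted to isotropic vectors: the number of partners of each depends
    -- only on the dimension.
    have h4 : ∑ W ∈ nonsingularSubspaces B U (2 * m + 2), ((isotropicVectors B W).card : ℝ) =
        (isotropicVectors B U).card * (q ^ ((2 * m + 1) * (2 * b)) * g) := by
      have h5 : (∑ W ∈ nonsingularSubspaces B U (2 * m + 2), ((isotropicVectors B W).card : ℝ)) *
          q ^ (2 * m + 2) = (∑ W ∈ nonsingularSubspaces B U (2 * m + 2),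
            ((hyperbolicPairs B W).card : ℝ)) * q ^ 2 := by
        rw [Finset.sum_mul, Finset.sum_mul]
        refine Finset.sum_congr rfl fun W hW => ?_
        obtain ⟨-, h6, h7⟩ := mem_nonsingularSubspaces.1 hW
        rw [hhyp W h6, h7]
      have h6 := hhyp U hU
      rw [hd] at h6
      refine mul_right_cancel₀ (pow_ne_zero (2 * m + 2) hq0) ?_
      rw [h5, h1]
      have e : q ^ (2 * (m + 1 + b)) * q ^ (2 * m * (2 * b)) =
          q ^ ((2 * m + 1) * (2 * b)) * q ^ (2 * m + 2) := by ring
      linear_combination q ^ (2 * m * (2 * b)) * g * h6 + (isotropicVectors B U).card * g * e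
    rw [Finset.sum_congr rfl hN, Finset.sum_sub_distrib, Finset.sum_const, nsmul_eq_mul, h3] at h4
    have h5 := hcard U
    rw [hd] at h5
    have h6 : ((nonsingularSubspaces B U (2 * m + 2)).card : ℝ) * (q ^ (2 * (m + 1)) - 1) =
        (q ^ (2 * (m + b + 1)) - 1) * (q ^ ((2 * m + 1) * (2 * b)) * g) := by
      rw [show m + b + 1 = m + 1 + b by omega]
      linear_combination h4 + q ^ ((2 * m + 1) * (2 * b)) * g * h5
    rw [pow_sub_one_eq_mul_one_sub hq0, pow_sub_one_eq_mul_one_sub hq0] at h6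
    have hg := gaussBinom_succ_succ_mul (t := q⁻¹ ^ 2) (by positivity) ht (Nat.le_add_right m b)
    have hlt : (q⁻¹ ^ 2) ^ (m + 1) < 1 :=
      pow_lt_one₀ (by positivity) (by linarith) (by omega)
    have hne : q ^ (2 * (m + 1)) * (1 - (q⁻¹ ^ 2) ^ (m + 1)) ≠ 0 := by
      have : 1 - (q⁻¹ ^ 2) ^ (m + 1) ≠ 0 := by linarith
      positivity
    refine mul_right_cancel₀ hne ?_
    rw [show m + 1 + b = m + b + 1 by omega]
    have e0 : 2 * (m + 1) = 2 * m + 2 := by omega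
    have e : q ^ (2 * (m + b + 1)) * q ^ ((2 * m + 1) * (2 * b)) =
        q ^ ((2 * (m + 1)) * (2 * b)) * q ^ (2 * (m + 1)) := by ring
    rw [← e0] at h6
    rw [h6]
    linear_combination (1 - (q⁻¹ ^ 2) ^ (m + b + 1)) * g * e -
      q ^ ((2 * (m + 1)) * (2 * b)) * q ^ (2 * (m + 1)) * hg

end SubspaceCounts

/-! ### Involutions and their `-1`-eigenspaces -/

section Involutions

variable {F V : Type*} [Field F] [AddCommGroup V] [Module F V]

theorem isSymm_polarBilin (Q : QuadraticForm F V) :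
    LinearMap.BilinForm.IsSymm (QuadraticMap.polarBilin Q) :=
  ⟨fun x y => QuadraticMap.polar_comm Q x y⟩

variable {Q : QuadraticForm F V}

theorem polarBilin_apply_of_mem {g : V ≃ₗ[F] V} (hg : g ∈ quadraticOrthogonalGroup Q) (x y : V) :
    Q.polarBilin (g x) (g y) = Q.polarBilin x y := by
  have hg : ∀ v, Q (g v) = Q v := hg
  simp only [QuadraticMap.polarBilin_apply_apply, QuadraticMap.polar, ← map_add, hg]

/-- The `-1` eigenspace of a linear automorphism. -/
def negEigenspace (g : V ≃ₗ[F] V) : Submodule F V where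
  carrier := {v | g v = -v}
  add_mem' {x y} hx hy := by
    have hx : g x = -x := hx
    have hy : g y = -y := hy
    change g (x + y) = -(x + y)
    rw [map_add, hx, hy, neg_add]
  zero_mem' := by simp
  smul_mem' c x hx := by
    have hx : g x = -x := hx
    change g (c • x) = -(c • x)
    rw [map_smul, hx, smul_neg]

theorem mem_negEigenspace {g : V ≃ₗ[F] V} {v : V} : v ∈ negEigenspace g ↔ g v = -v := Iff.rfl

theorem apply_apply_of_sq_eq_one {g : V ≃ₗ[F] V} (hg2 : g ^ 2 = 1) (v : V) : g (g v) = v := by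
  have h : (g ^ 2) v = (1 : V ≃ₗ[F] V) v := by rw [hg2]
  rwa [sq, LinearEquiv.mul_apply] at h

theorem sub_apply_mem_negEigenspace {g : V ≃ₗ[F] V} (hg2 : g ^ 2 = 1) (v : V) :
    v - g v ∈ negEigenspace g := by
  rw [mem_negEigenspace, map_sub, apply_apply_of_sq_eq_one hg2, neg_sub]

/-- For `x` in the eigenspace, `B (g y) x = -B y x`, so orthogonality of `x` to `y - g y` reads `2 *
B y x = 0` for every `y`. -/
theorem isNonsingular_negEigenspace (h2 : (2 : F) ≠ 0) (hQ : Q.polarBilin.Nondegenerate)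
    {g : V ≃ₗ[F] V} (hg : g ∈ quadraticOrthogonalGroup Q) (hg2 : g ^ 2 = 1) :
    IsNonsingular Q.polarBilin (negEigenspace g) := by
  refine isNonsingular_of_forall fun x hx h => hQ.2 x fun y => ?_
  have hx : g x = -x := hx
  have h1 := h _ (sub_apply_mem_negEigenspace hg2 y)
  have h3 := polarBilin_apply_of_mem hg y x
  rw [hx, map_neg] at h3
  rw [map_sub, LinearMap.sub_apply] at h1
  have : 2 * Q.polarBilin y x = 0 := by linear_combination h1 - h3
  exact (mul_eq_zero.1 this).resolve_left h2

/-- The vector `v - g v` lies in the eigenspace and is orthogonal to it, hence is zero. -/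
theorem apply_eq_self_of_mem_orthogonal (h2 : (2 : F) ≠ 0) (hQ : Q.polarBilin.Nondegenerate)
    {g : V ≃ₗ[F] V} (hg : g ∈ quadraticOrthogonalGroup Q) (hg2 : g ^ 2 = 1) {v : V}
    (hv : v ∈ LinearMap.BilinForm.orthogonal Q.polarBilin (negEigenspace g)) : g v = v := by
  refine (sub_eq_zero.1 ((isNonsingular_negEigenspace h2 hQ hg hg2).eq_zero
    (sub_apply_mem_negEigenspace hg2 v) fun w hw => ?_)).symm
  have h1 : Q.polarBilin w v = 0 := hv w hw
  have h3 := polarBilin_apply_of_mem hg w v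
  rw [mem_negEigenspace.1 hw, map_neg, LinearMap.neg_apply] at h3
  rw [map_sub]
  linear_combination 2 * h1 + h3

variable [FiniteDimensional F V]

theorem eq_of_negEigenspace_eq (h2 : (2 : F) ≠ 0) (hQ : Q.polarBilin.Nondegenerate)
    {g h : V ≃ₗ[F] V} (hg : g ∈ quadraticOrthogonalGroup Q) (hg2 : g ^ 2 = 1)
    (hh : h ∈ quadraticOrthogonalGroup Q) (hh2 : h ^ 2 = 1)
    (heq : negEigenspace g = negEigenspace h) : g = h := by
  ext v
  have hv : v ∈ negEigenspace g ⊔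
      LinearMap.BilinForm.orthogonal Q.polarBilin (negEigenspace g) := by
    rw [((isNonsingular_negEigenspace h2 hQ hg hg2).isCompl (isSymm_polarBilin Q)).sup_eq_top]
    trivial
  obtain ⟨a, ha, b, hb, rfl⟩ := Submodule.mem_sup.1 hv
  have ha' : a ∈ negEigenspace h := heq ▸ ha
  have hb' : h b = b := apply_eq_self_of_mem_orthogonal h2 hQ hh hh2 (heq ▸ hb)
  rw [map_add, map_add, mem_negEigenspace.1 ha, mem_negEigenspace.1 ha', hb',
    apply_eq_self_of_mem_orthogonal h2 hQ hg hg2 hb]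

theorem exists_negEigenspace_eq (h2 : (2 : F) ≠ 0) {W : Submodule F V}
    (hW : IsNonsingular Q.polarBilin W) :
    ∃ g ∈ quadraticOrthogonalGroup Q, g ^ 2 = 1 ∧ negEigenspace g = W := by
  have hc := hW.isCompl (isSymm_polarBilin Q)
  set W' := LinearMap.BilinForm.orthogonal Q.polarBilin W with hW'
  -- The map equal to `-1` on `W` and `1` on its orthogonal complement.
  let f : V →ₗ[F] V := LinearMap.id - (2 : F) • W.projection W' hc
  have hfa : ∀ a ∈ W, f a = -a := fun a ha => by
    have := W.projection_apply_left hc ⟨a, ha⟩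
    simp only at this
    change a - (2 : F) • W.projection W' hc a = -a
    rw [this, two_smul]
    abel
  have hfb : ∀ b ∈ W', f b = b := fun b hb => by
    have := (W.projection_apply_eq_zero_iff hc).2 hb
    simp [f, this]
  have hdec : ∀ v : V, ∃ a ∈ W, ∃ b ∈ W', a + b = v := fun v =>
    Submodule.mem_sup.1 (by rw [hc.sup_eq_top]; trivial)
  have hff : ∀ v, f (f v) = v := fun v => by
    obtain ⟨a, ha, b, hb, rfl⟩ := hdec v
    rw [map_add, hfa a ha, hfb b hb, map_add, hfb b hb, map_neg, hfa a ha, neg_neg]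
  have hQ' : ∀ a ∈ W, ∀ b ∈ W', Q.polarBilin a b = 0 := fun a ha b hb => hb a ha
  refine ⟨LinearEquiv.ofInvolutive f hff, fun v => ?_, ?_, ?_⟩
  · change Q (f v) = Q v
    obtain ⟨a, ha, b, hb, rfl⟩ := hdec v
    have h3 := hQ' a ha b hb
    have h4 := hQ' (-a) (W.neg_mem ha) b hb
    rw [QuadraticMap.polarBilin_apply_apply, QuadraticMap.polar] at h3 h4
    rw [map_add, hfa a ha, hfb b hb]
    rw [QuadraticMap.map_neg] at h4
    linear_combination h4 - h3
  · ext v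
    rw [sq, LinearEquiv.mul_apply]
    exact hff v
  · ext v
    rw [mem_negEigenspace]
    change f v = -v ↔ _
    refine ⟨fun h => ?_, hfa v⟩
    obtain ⟨a, ha, b, hb, rfl⟩ := hdec v
    rw [map_add, hfa a ha, hfb b hb, neg_add, add_right_inj, eq_neg_iff_add_eq_zero,
      ← two_smul F, smul_eq_zero] at h
    rw [h.resolve_left h2, add_zero]
    exact ha

/-- Involutions of the orthogonal group correspond to nonsingular subspaces. -/
theorem numInvolutions_eq_card_isNonsingular (h2 : (2 : F) ≠ 0)
    (hQ : Q.polarBilin.Nondegenerate) :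
    numInvolutions (quadraticOrthogonalGroup Q) =
      Nat.card {W : Submodule F V // IsNonsingular Q.polarBilin W} := by
  refine Nat.card_congr (Equiv.ofBijective (fun g => ⟨negEigenspace g.1.1,
    isNonsingular_negEigenspace h2 hQ g.1.2 (by
      have := congrArg Subtype.val g.2
      simpa using this)⟩) ⟨?_, ?_⟩)
  · rintro ⟨⟨g, hg⟩, hg2⟩ ⟨⟨h, hh⟩, hh2⟩ heq
    have hg2 : g ^ 2 = 1 := by simpa using congrArg Subtype.val hg2
    have hh2 : h ^ 2 = 1 := by simpa using congrArg Subtype.val hh2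
    have heq : negEigenspace g = negEigenspace h := congrArg Subtype.val heq
    have := eq_of_negEigenspace_eq h2 hQ hg hg2 hh hh2 heq
    subst this
    rfl
  · rintro ⟨W, hW⟩
    obtain ⟨g, hg, hg2, rfl⟩ := exists_negEigenspace_eq h2 hW
    exact ⟨⟨⟨g, hg⟩, Subtype.ext (by simpa using hg2)⟩, rfl⟩

end Involutions

/-! ### Passage to the limit -/

section Limit

variable {F V : Type*} [Field F] [AddCommGroup V] [Module F V]

theorem card_isNonsingular_eq_sum [Finite V] (B : BilinForm F V) {d : ℕ} (hd : finrank F V = d) :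
    Nat.card {W : Submodule F V // IsNonsingular B W} =
      ∑ k ∈ Finset.range (d + 1), (nonsingularSubspaces B ⊤ k).card := by
  classical
  have h := Finset.card_eq_sum_card_fiberwise (f := fun W : Submodule F V => finrank F W)
    (s := (Set.toFinite {W | IsNonsingular B W}).toFinset) (t := Finset.range (d + 1)) ?_
  · rw [← Nat.card_eq_card_finite_toFinset] at h
    refine Eq.trans ?_ (h.trans (Finset.sum_congr rfl fun k _ => congrArg _ ?_))
    · rfl
    · ext W
      simp
  · intro W _
    simp only [Finset.coe_range, Set.mem_Iio]
    have := Submodule.finrank_le W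
    omega

/-- With `t = q⁻²`, the number of nonsingular subspaces of dimension `k` of a nonsingular space of
dimension `2 * (n + 1)`, divided by `q ^ (k * (2 * (n + 1) - k))`. The constant `c` depends on the
type of the space. -/
noncomputable def subspaceDensity (t c : ℝ) (n k : ℕ) : ℝ :=
  if Even k then gaussBinom t (n + 1) (k / 2) else c * gaussBinom t n (k / 2)

theorem exists_numInvolutions_eq_sum [Fintype F] {Q : QuadraticForm F V} (h2 : (2 : F) ≠ 0)
    (hQ : Q.polarBilin.Nondegenerate) {n : ℕ} (hd : finrank F V = 2 * (n + 1)) :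
    ∃ c : ℝ, |c - 1| ≤ (Nat.card F : ℝ)⁻¹ ^ (n + 1) ∧
      (numInvolutions (quadraticOrthogonalGroup Q) : ℝ) / (Nat.card F : ℝ) ^ ((n + 1) ^ 2) =
        ∑ k ∈ Finset.range (2 * (n + 1) + 1),
          (Nat.card F : ℝ)⁻¹ ^ (((k : ℤ) - (n + 1 : ℕ)) ^ 2) *
            subspaceDensity ((Nat.card F : ℝ)⁻¹ ^ 2) c n k := by
  have : FiniteDimensional F V := FiniteDimensional.of_finrank_pos (by omega)
  have : Finite V := Module.finite_of_finite F
  have hB := isSymm_polarBilin Q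
  have hU : IsNonsingular Q.polarBilin ⊤ := isNonsingular_of_forall fun x _ h =>
    hQ.2 x fun y => h y trivial
  have hd' : finrank F (⊤ : Submodule F V) = 2 * (n + 1) := by rw [finrank_top, hd]
  have hq0 : (Nat.card F : ℝ) ≠ 0 := by exact_mod_cast Nat.card_pos.ne'
  obtain ⟨c, hc, hodd⟩ := card_nonsingularSubspaces_odd_even hB h2 hU hd'
  refine ⟨c, hc, ?_⟩
  rw [numInvolutions_eq_card_isNonsingular h2 hQ, card_isNonsingular_eq_sum _ hd, Nat.cast_sum,
    Finset.sum_div]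
  refine Finset.sum_congr rfl fun k hk => ?_
  have hk : k ≤ 2 * (n + 1) := Nat.lt_succ_iff.1 (Finset.mem_range.1 hk)
  rw [div_eq_iff (pow_ne_zero _ hq0)]
  -- Completing the square: `k * l = (n+1)² - (k-(n+1))²` when `k + l = 2(n+1)`.
  have hexp : ∀ l : ℕ, k + l = 2 * (n + 1) → (Nat.card F : ℝ)⁻¹ ^ (((k : ℤ) - (n + 1 : ℕ)) ^ 2) *
      (Nat.card F : ℝ) ^ ((n + 1) ^ 2) = (Nat.card F : ℝ) ^ (k * l) := fun l hl => by
    rw [inv_zpow', ← zpow_natCast, ← zpow_natCast, ← zpow_add₀ hq0]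
    congr 1
    have : (k : ℤ) + l = 2 * (n + 1) := by exact_mod_cast hl
    push_cast
    linear_combination (-(k : ℤ)) * this
  rw [subspaceDensity]
  split_ifs with he
  · obtain ⟨m, rfl⟩ := he
    obtain ⟨b, hb⟩ := Nat.exists_eq_add_of_le (show m ≤ n + 1 by omega)
    have h := card_nonsingularSubspaces_even_even hB h2 hU m b (by omega)
    rw [show m + m = 2 * m by omega] at *
    rw [h, ← hexp (2 * b) (by omega), ← hb, Nat.mul_div_cancel_left _ two_pos]
    ring
  · obtain ⟨m, rfl⟩ := Nat.not_even_iff_odd.1 he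
    obtain ⟨b, hb⟩ := Nat.exists_eq_add_of_le (show m ≤ n by omega)
    rw [hodd m b hb.symm, ← hexp (2 * b + 1) (by omega), show (2 * m + 1) / 2 = m by omega]
    ring

/-- At a fixed offset `j` from the middle, the lower index is about `n / 2` for either parity, so it
and its complement both tend to infinity. -/
theorem tendsto_subspaceDensity {t : ℝ} (h0 : 0 ≤ t) (h1 : t ≤ 1 / 3) {L : ℝ} (hL : 0 < L)
    (h : Tendsto (eulerProd t) atTop (𝓝 L)) {c : ℕ → ℝ} (hc : Tendsto c atTop (𝓝 1)) (j : ℤ) :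
    Tendsto (fun n : ℕ => subspaceDensity t (c n) n (((n + 1 : ℕ) : ℤ) + j).toNat) atTop
      (𝓝 L⁻¹) := by
  have hatTop : ∀ f : ℕ → ℕ, (∀ n, n ≤ 2 * f n + 2 + j.natAbs) → Tendsto f atTop atTop :=
    fun f hf => tendsto_atTop.2 fun b => by
      filter_upwards [eventually_ge_atTop (2 * b + 2 + j.natAbs)] with n hn
      have := hf n
      omega
  have e1 : Tendsto (fun n : ℕ => gaussBinom t (n + 1) ((((n + 1 : ℕ) : ℤ) + j).toNat / 2)) atTop
      (𝓝 L⁻¹) := by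
    refine (tendsto_gaussBinom h0 h1 hL h
      (a := fun n => (((n + 1 : ℕ) : ℤ) + j).toNat / 2)
      (b := fun n => n + 1 - (((n + 1 : ℕ) : ℤ) + j).toNat / 2)
      (hatTop _ fun n => by omega) (hatTop _ fun n => by omega)).congr' ?_
    filter_upwards [eventually_ge_atTop j.natAbs] with n hn
    congr 1
    omega
  have e2 : Tendsto (fun n : ℕ => gaussBinom t n ((((n + 1 : ℕ) : ℤ) + j).toNat / 2)) atTop
      (𝓝 L⁻¹) := by
    refine (tendsto_gaussBinom h0 h1 hL h
      (a := fun n => (((n + 1 : ℕ) : ℤ) + j).toNat / 2)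
      (b := fun n => n - (((n + 1 : ℕ) : ℤ) + j).toNat / 2)
      (hatTop _ fun n => by omega) (hatTop _ fun n => by omega)).congr' ?_
    filter_upwards [eventually_ge_atTop (j.natAbs + 1)] with n hn
    congr 1
    omega
  have e3 := hc.mul e2
  rw [one_mul] at e3
  unfold subspaceDensity
  exact e1.if' e3

theorem abs_subspaceDensity_le {t c : ℝ} (h0 : 0 ≤ t) (h1 : t ≤ 1 / 3) (hc : |c| ≤ 2)
    (n k : ℕ) : |subspaceDensity t c n k| ≤ 8 := by
  have h3 : ∀ a b, |gaussBinom t a b| ≤ 4 := fun a b => by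
    rw [abs_of_nonneg (gaussBinom_nonneg h0 a b)]
    exact gaussBinom_le_four h0 h1 a b
  rw [subspaceDensity]
  split_ifs
  · exact (h3 _ _).trans (by norm_num)
  · rw [abs_mul]
    nlinarith [h3 n (k / 2), abs_nonneg (gaussBinom t n (k / 2)), abs_nonneg c]

theorem multipliable_one_add_pow_sq {y : ℝ} (hy : 0 < y) (hy1 : y < 1) :
    Multipliable fun i : ℕ => (1 + y ^ (2 * i + 1)) ^ 2 := by
  have hs : Summable fun i : ℕ => y ^ (2 * i + 1) := by
    refine (summable_geometric_of_lt_one hy.le hy1).of_nonneg_of_le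
      (fun n => by positivity) fun n => ?_
    exact pow_le_pow_of_le_one hy.le hy1.le (by omega)
  have hm := Real.multipliable_one_add_of_summable hs
  simp_rw [sq]
  exact hm.mul hm

end Limit

/-- The argument applies to every nondegenerate form, so `htype` is not needed: the type affects the
count only through a factor `1 + O(q⁻ⁿ)` on the odd-dimensional subspaces. -/
theorem mainTheorem8 {F : Type*} [Field F] [Fintype F] (q : ℕ) (hq : Fintype.card F = q)
    (hodd : Odd q) (ε : OrthogonalType)
    (V : ℕ → Type*) [∀ n, AddCommGroup (V n)] [∀ n, Module F (V n)]
    (Q : ∀ n, QuadraticForm F (V n))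
    (hdim : ∀ n, 1 ≤ n → Module.finrank F (V n) = 2 * n)
    (hnondeg : ∀ n, 1 ≤ n → (QuadraticMap.polarBilin (Q n)).Nondegenerate)
    (htype : ∀ n, 1 ≤ n → HasOrthogonalType (Q n) n ε) :
    Multipliable (fun i : ℕ => (1 + 1 / (q : ℝ) ^ (2 * i + 1)) ^ 2) ∧
    Tendsto
      (fun n : ℕ => (numInvolutions (quadraticOrthogonalGroup (Q n)) : ℝ) / (q : ℝ) ^ (n ^ 2))
      atTop (𝓝 (∏' i : ℕ, (1 + 1 / (q : ℝ) ^ (2 * i + 1)) ^ 2)) := by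
  have h2 : (2 : F) ≠ 0 := by
    refine Ring.two_ne_zero fun hc => ?_
    have := FiniteField.even_card_of_char_two hc
    rw [hq] at this
    exact (Nat.not_even_iff_odd.2 hodd) (Nat.even_iff.2 this)
  have hqc : q = Nat.card F := by rw [Nat.card_eq_fintype_card, hq]
  subst hqc
  have hq3 : (3 : ℝ) ≤ Nat.card F := by exact_mod_cast three_le_natCard_of_two_ne_zero h2
  have ht := inv_sq_card_le h2
  simp_rw [one_div, ← inv_pow]
  set y : ℝ := (Nat.card F : ℝ)⁻¹ with hydef
  have hy : 0 < y := by positivity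
  have hy1 : y < 1 := inv_lt_one_of_one_lt₀ (by linarith)
  have ht0 : 0 ≤ y ^ 2 := by positivity
  have hm := multipliable_one_add_pow_sq hy hy1
  refine ⟨hm, ?_⟩
  rw [← tendsto_add_atTop_iff_nat 1]
  have hex := fun n : ℕ => exists_numInvolutions_eq_sum h2 (hnondeg (n + 1) (by omega))
    (hdim (n + 1) (by omega))
  choose c hc hsum using hex
  rw [← hydef] at hsum hc
  have hc1 : Tendsto c atTop (𝓝 1) := by
    refine tendsto_iff_norm_sub_tendsto_zero.2 (squeeze_zero (fun n => norm_nonneg _) hc ?_)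
    exact (tendsto_pow_atTop_nhds_zero_of_lt_one hy.le hy1).comp (tendsto_add_atTop_nat 1)
  have hc2 : ∀ n, |c n| ≤ 2 := fun n => by
    have h3 : y ^ (n + 1) ≤ 1 := pow_le_one₀ hy.le hy1.le
    have h4 := abs_le.1 ((hc n).trans h3)
    exact abs_le.2 ⟨by linarith [h4.1], by linarith [h4.2]⟩
  obtain ⟨L, hL, hLt⟩ := exists_tendsto_eulerProd ht0 ht
  have hprod := (tendsto_add_atTop_iff_nat 1).2 hm.hasProd.tendsto_prod_nat
  -- The coefficients of the involution sum are compared with those of the triple product; the bound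
  -- is `8 + 4`. The value at `n = 0` is a filler, because the densities use `n - 1`.
  have hdiff := tendsto_sum_pow_sq_mul hy hy1 (C := 12)
    (δ := fun n k => if n = 0 then 0 else
      subspaceDensity (y ^ 2) (c (n - 1)) (n - 1) k - gaussBinom (y ^ 2) (n + n) k) ?_ ?_
  · have := ((tendsto_add_atTop_iff_nat 1).2 hdiff).add hprod
    rw [zero_add] at this
    refine this.congr fun n => ?_
    rw [hsum, ← thetaSum_self hy ht, thetaSum, show n + 1 + (n + 1) + 1 = 2 * (n + 1) + 1 by omega,
      ← Finset.sum_add_distrib]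
    refine Finset.sum_congr rfl fun k _ => ?_
    rw [if_neg (Nat.succ_ne_zero n), Nat.add_sub_cancel]
    ring
  · intro n k _
    split_ifs
    · norm_num
    · refine (abs_sub _ _).trans ?_
      have h3 := abs_subspaceDensity_le ht0 ht (hc2 (n - 1)) (n - 1) k
      rw [abs_of_nonneg (gaussBinom_nonneg ht0 (n + n) k)]
      linarith [gaussBinom_le_four ht0 ht (n + n) k]
  · intro j
    rw [← tendsto_add_atTop_iff_nat 1]
    have e1 := tendsto_subspaceDensity ht0 ht hL hLt hc1 j
    have hatTop : ∀ f : ℕ → ℕ, (∀ n, n ≤ f n + j.natAbs) → Tendsto f atTop atTop :=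
      fun f hf => tendsto_atTop.2 fun b => by
        filter_upwards [eventually_ge_atTop (b + j.natAbs)] with n hn
        have := hf n
        omega
    have e2 : Tendsto (fun n : ℕ => gaussBinom (y ^ 2) (n + 1 + (n + 1))
        (((n + 1 : ℕ) : ℤ) + j).toNat) atTop (𝓝 L⁻¹) := by
      refine (tendsto_gaussBinom ht0 ht hL hLt
        (a := fun n => (((n + 1 : ℕ) : ℤ) + j).toNat)
        (b := fun n => n + 1 + (n + 1) - (((n + 1 : ℕ) : ℤ) + j).toNat)
        (hatTop _ fun n => by omega) (hatTop _ fun n => by omega)).congr' ?_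
      filter_upwards [eventually_ge_atTop j.natAbs] with n hn
      congr 1
      omega
    have e3 := e1.sub e2
    rw [sub_self] at e3
    refine e3.congr fun n => ?_
    rw [if_neg (Nat.succ_ne_zero n), Nat.add_sub_cancel]
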